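/- \textbf{Formulae.} Propositional variables are named by binary strings, and all formulae are in negation normal form. Formulae of modal dependence logic (MDL) are given by $\phi ::= p \mid \neg p \mid \mathrm{dep}(p_1,\dots,p_k,q) \mid (\phi\wedge\phi)\mid(\phi\vee\phi)\mid\Box\phi\mid\Diamond\phi$ $(k\ge 0)$, and formulae of quantified propositional dependence logic (QPDL) by $\phi ::= p \mid \neg p \mid \mathrm{dep}(p_1,\dots,p_k,q) \mid (\phi\wedge\phi)\mid(\phi\vee\phi)\mid\exists p\,\phi\mid\forall p\,\phi$ $(k\ge 0)$. \textbf{MDL semantics.} Let $\mathcal M=(W,R,\pi)$ be a Kripke model over a set $V$ of variables containing those of the formula ($W\neq\emptyset$, $R\subseteq W\times W$, $\pi\colon V\to\mathcal P(W)$), and let $T\subseteq W$ be a team. Then: $\mathcal M,T\models p$ iff $T\subseteq\pi(p)$; $\mathcal M,T\models\neg p$ iff $T\cap\pi(p)=\emptyset$; $\mathcal M,T\models \mathrm{dep}(p_1,\dots,p_k,q)$ iff any two worlds of $T$ that agree on the truth values of $p_1,\dots,p_k$ agree on that of $q$; conjunction is read as usual; $\mathcal M,T\models\phi\vee\psi$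 iff $T=T_1\cup T_2$ for some $T_1,T_2$ with $\mathcal M,T_1\models\phi$ and $\mathcal M,T_2\models\psi$; $\mathcal M,T\models\Box\phi$ iff $\mathcal M,R[T]\models\phi$, where $R[T]$ is the set of $R$-successors of worlds of $T$; $\mathcal M,T\models\Diamond\phi$ iff $\mathcal M,T'\models\phi$ for some $T'\subseteq R[T]$ such that every $w\in T$ has an $R$-successor in $T'$. \textbf{QPDL semantics.} A team over $V$ is a set $X$ of assignments $s\colon V\to\{0,1\}$, where $V$ contains the free variables of the formula. Literals, dependence atoms, $\wedge$ and $\vee$ are interpreted as above, with assignments in place of worlds. $X\models\forall p\,\phi$ iff $\{s(a/p)\mid s\in X,\ a\in\{0,1\}\}\models\phi$, and $X\models\exists p\,\phi$ iff there is $F\colon X\to\{\{0\},\{1\},\{0,1\}\}$ with $\{s(a/p)\mid s\in X,\ a\in F(s)\}\models\phi$; here $s(a/p)$ is the assignment over $V\cup\{p\}$ that maps $p$ to $a$ and otherwise agrees with $s$. \textbf{Problems.} For each of the two logics: the satisfiability problem asks whether a given formula is satisfied by some non-empty team (of some Kripke model, in the case of MDL); the validity problem asks whether a given formula is satisfied by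 all teams (of all Kripke models); the entailment problem asks, for a given finite set $\Sigma$ of formulae, presented as a list, and a formula $\phi$, whether every team (of every Kripke model) that satisfies all formulae of $\Sigma$ satisfies $\phi$. \textbf{Theorem.} The satisfiability, validity and entailment problems for QPDL are polynomial-time many-one reducible to the satisfiability, validity and entailment problems for MDL, respectively: for each of the three problems there is a function from QPDL instances to MDL instances, computable by a Turing machine in time polynomial in the length of the instance written as a string over a finite alphabet, such that an instance is a yes-instance if and only if its image is. -/

import Mathlib

universe u

/-- Propositional variables: a countably infinite supply, the names being binary strings. -/
abbrev PropVar : Type := List Bool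

/-! ### Modal dependence logic -/

namespace MDL

/-- Formulae of modal dependence logic in negation normal form. `dep ps q` is the dependence
atom `dep(p₁,…,pₙ,q)`; the sequence `ps` may be empty. -/
inductive Formula : Type
  | pos (p : PropVar)
  | neg (p : PropVar)
  | dep (ps : List PropVar) (q : PropVar)
  | conj (φ ψ : Formula)
  | disj (φ ψ : Formula)
  | box (φ : Formula)
  | dia (φ : Formula)

/-- The set of variables appearing in a formula. -/
def Formula.vars : Formula → Set PropVar
  | pos p => {p}
  | neg p => {p}
  | dep ps q => {p | p ∈ ps} ∪ {q}
  | conj φ ψ => φ.vars ∪ ψ.vars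
  | disj φ ψ => φ.vars ∪ ψ.vars
  | box φ => φ.vars
  | dia φ => φ.vars

/-- A Kripke model `(W, R, π)` over a set `V` of propositional variables. -/
structure KripkeModel (V : Set PropVar) : Type (u + 1) where
  W : Type u
  nonempty : Nonempty W
  R : W → W → Prop
  π : V → Set W

namespace KripkeModel

variable {V : Set PropVar} (M : KripkeModel.{u} V)

/-- `π(p)` as a set of worlds. (Only used for `p ∈ V`.) -/
def truthSet (p : PropVar) : Set M.W := {w | ∃ h : p ∈ V, w ∈ M.π ⟨p, h⟩}

/-- The set `R[T]` of successors of a team. -/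
def successors (T : Set M.W) : Set M.W := {w | ∃ w' ∈ T, M.R w' w}

/-- The set `R⟨T⟩` of legal successor teams of a team. -/
def legalSuccessors (T : Set M.W) : Set (Set M.W) :=
  {T' | T' ⊆ M.successors T ∧ ∀ w ∈ T, ∃ w' ∈ T', M.R w w'}

/-- (Lax) team semantics; meaningful when the variables of the formula belong to `V`. -/
def Sat {V : Set PropVar} (M : KripkeModel.{u} V) : Set M.W → Formula → Prop
  | T, .pos p => T ⊆ M.truthSet p
  | T, .neg p => T ∩ M.truthSet p = ∅
  | T, .dep ps q => ∀ w ∈ T, ∀ w' ∈ T,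
      (∀ p ∈ ps, (w ∈ M.truthSet p ↔ w' ∈ M.truthSet p)) →
        (w ∈ M.truthSet q ↔ w' ∈ M.truthSet q)
  | T, .conj φ ψ => Sat M T φ ∧ Sat M T ψ
  | T, .disj φ ψ => ∃ T₁ T₂ : Set M.W, T₁ ∪ T₂ = T ∧ Sat M T₁ φ ∧ Sat M T₂ ψ
  | T, .box φ => Sat M (M.successors T) φ
  | T, .dia φ => ∃ T' ∈ M.legalSuccessors T, Sat M T' φ

end KripkeModel

/-- Some Kripke model and some non-empty team satisfy `φ`. -/
def Satisfiable (φ : Formula) : Prop :=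
  ∃ (V : Set PropVar) (M : KripkeModel.{u} V) (T : Set M.W),
    φ.vars ⊆ V ∧ T.Nonempty ∧ M.Sat T φ

/-- All Kripke models and all teams satisfy `φ`. -/
def Valid (φ : Formula) : Prop :=
  ∀ (V : Set PropVar) (M : KripkeModel.{u} V) (T : Set M.W), φ.vars ⊆ V → M.Sat T φ

/-- `Σ ⊨ φ`. -/
def Entails (S : Set Formula) (φ : Formula) : Prop :=
  ∀ (V : Set PropVar) (M : KripkeModel.{u} V) (T : Set M.W),
    (∀ ψ ∈ S, ψ.vars ⊆ V) → φ.vars ⊆ V → (∀ ψ ∈ S, M.Sat T ψ) → M.Sat T φ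

end MDL

/-! ### Quantified propositional dependence logic -/

namespace QPDL

/-- Formulae of quantified propositional dependence logic in negation normal form. -/
inductive Formula : Type
  | pos (p : PropVar)
  | neg (p : PropVar)
  | dep (ps : List PropVar) (q : PropVar)
  | conj (φ ψ : Formula)
  | disj (φ ψ : Formula)
  | ex (p : PropVar) (φ : Formula)
  | all (p : PropVar) (φ : Formula)

/-- The set of free variables of a formula. -/
def Formula.free : Formula → Set PropVar
  | pos p => {p}
  | neg p => {p}
  | dep ps q => {p | p ∈ ps} ∪ {q}
  | conj φ ψ => φ.free ∪ ψ.free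
  | disj φ ψ => φ.free ∪ ψ.free
  | ex p φ => φ.free \ {p}
  | all p φ => φ.free \ {p}

/-- Propositional assignments over `V`. -/
abbrev Assignment (V : Set PropVar) : Type := V → Bool

/-- Propositional teams over `V`. -/
abbrev Team (V : Set PropVar) : Type := Set (Assignment V)

variable {V : Set PropVar}

/-- The assignment `s(a/p)` over `V ∪ {p}`. -/
def Assignment.update (s : Assignment V) (p : PropVar) (a : Bool) : Assignment (insert p V) :=
  fun x => if h : x.1 = p then a else s ⟨x.1, x.2.resolve_left h⟩

/-- `s(p) = 1`. (Only used for `p ∈ V`.) -/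
def Assignment.Holds (s : Assignment V) (p : PropVar) : Prop := ∃ h : p ∈ V, s ⟨p, h⟩ = true

/-- The duplication team `X[{0,1}/p]`. -/
def Team.duplicate (X : Team V) (p : PropVar) : Team (insert p V) :=
  {t | ∃ s ∈ X, ∃ a : Bool, t = s.update p a}

/-- The supplementation team `X[F/p]`. -/
def Team.supplement (X : Team V) (F : X → Set Bool) (p : PropVar) : Team (insert p V) :=
  {t | ∃ s : X, ∃ a ∈ F s, t = s.1.update p a}

/-- (Lax) team semantics; meaningful when the free variables of the formula belong to `V`. -/
def Sat : (V : Set PropVar) → Team V → Formula → Prop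
  | _, X, .pos p => ∀ s ∈ X, s.Holds p
  | _, X, .neg p => ∀ s ∈ X, ¬ s.Holds p
  | _, X, .dep ps q => ∀ s ∈ X, ∀ s' ∈ X,
      (∀ p ∈ ps, (s.Holds p ↔ s'.Holds p)) → (s.Holds q ↔ s'.Holds q)
  | V, X, .conj φ ψ => Sat V X φ ∧ Sat V X ψ
  | V, X, .disj φ ψ => ∃ X₁ X₂ : Team V, X₁ ∪ X₂ = X ∧ Sat V X₁ φ ∧ Sat V X₂ ψ
  | V, X, .ex p φ => ∃ F : X → Set Bool, (∀ s, (F s).Nonempty) ∧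
      Sat (insert p V) (X.supplement F p) φ
  | V, X, .all p φ => Sat (insert p V) (X.duplicate p) φ

/-- Some non-empty team satisfies `φ`. -/
def Satisfiable (φ : Formula) : Prop :=
  ∃ (V : Set PropVar) (X : Team V), φ.free ⊆ V ∧ X.Nonempty ∧ Sat V X φ

/-- All teams satisfy `φ`. -/
def Valid (φ : Formula) : Prop :=
  ∀ (V : Set PropVar) (X : Team V), φ.free ⊆ V → Sat V X φ

/-- `Σ ⊨ φ`. -/
def Entails (S : Set Formula) (φ : Formula) : Prop :=
  ∀ (V : Set PropVar) (X : Team V),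
    (∀ ψ ∈ S, ψ.free ⊆ V) → φ.free ⊆ V → (∀ ψ ∈ S, Sat V X ψ) → Sat V X φ

end QPDL

/-! ### Formulae as strings over a finite alphabet -/

/-- The symbols in which formulae and entailment instances are written. -/
inductive Token : Type
  | bit (b : Bool)
  | sep
  | pos
  | neg
  | dep
  | conj
  | disj
  | box
  | dia
  | ex
  | all
  | close
  | turnstile
  deriving DecidableEq, Fintype

/-- A variable is written as its name followed by a separator. -/
def writeVar (p : PropVar) : List Token := p.map Token.bit ++ [Token.sep]

/-- Prefix notation, every compound formula and dependence atom being closed by a bracket. -/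
def MDL.Formula.write : MDL.Formula → List Token
  | pos p => Token.pos :: writeVar p
  | neg p => Token.neg :: writeVar p
  | dep ps q => Token.dep :: ((ps ++ [q]).flatMap writeVar ++ [Token.close])
  | conj φ ψ => Token.conj :: (φ.write ++ (ψ.write ++ [Token.close]))
  | disj φ ψ => Token.disj :: (φ.write ++ (ψ.write ++ [Token.close]))
  | box φ => Token.box :: (φ.write ++ [Token.close])
  | dia φ => Token.dia :: (φ.write ++ [Token.close])

/-- Prefix notation, every compound formula and dependence atom being closed by a bracket. -/
def QPDL.Formula.write : QPDL.Formula → List Token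
  | pos p => Token.pos :: writeVar p
  | neg p => Token.neg :: writeVar p
  | dep ps q => Token.dep :: ((ps ++ [q]).flatMap writeVar ++ [Token.close])
  | conj φ ψ => Token.conj :: (φ.write ++ (ψ.write ++ [Token.close]))
  | disj φ ψ => Token.disj :: (φ.write ++ (ψ.write ++ [Token.close]))
  | ex p φ => Token.ex :: (writeVar p ++ (φ.write ++ [Token.close]))
  | all p φ => Token.all :: (writeVar p ++ (φ.write ++ [Token.close]))

/-- An entailment instance `(Σ, φ)`, the finite set `Σ` being given as a list: the formulae of
`Σ`, a turnstile, and `φ`. -/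
def writeSequent {α : Type} (write : α → List Token) (i : List α × α) : List Token :=
  i.1.flatMap write ++ Token.turnstile :: write i.2

/-- An injective map into strings, with the partial inverse as decoding. -/
noncomputable def encodingOfInjective {α : Type} (write : α → List Token)
    (h : Function.Injective write) : Computability.Encoding α Token where
  encode := write
  decode := Function.partialInv write
  decode_encode := Function.partialInv_left h

theorem writeVar_append_inj {p q : PropVar} {r r' : List Token}
    (h : writeVar p ++ r = writeVar q ++ r') : p = q ∧ r = r' := by
  induction p generalizing q with
  | nil => cases q <;> simp_all [writeVar]
  | cons a p ih =>
    cases q with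
    | nil => simp [writeVar] at h
    | cons b q =>
      simp only [writeVar, List.map_cons, List.cons_append, List.cons.injEq, Token.bit.injEq] at h
      obtain ⟨hp, hr⟩ := ih (q := q) h.2
      exact ⟨by rw [h.1, hp], hr⟩

theorem writeVar_ne_close {p : PropVar} {r r' : List Token} :
    writeVar p ++ r ≠ Token.close :: r' := by
  cases p <;> simp [writeVar]

theorem writeVars_append_inj {l l' : List PropVar} {r r' : List Token}
    (h : l.flatMap writeVar ++ Token.close :: r = l'.flatMap writeVar ++ Token.close :: r') :
    l = l' ∧ r = r' := by
  induction l generalizing l' with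
  | nil =>
    cases l' with
    | nil => simpa using h
    | cons q l' =>
      rw [List.flatMap_cons, List.append_assoc] at h
      exact absurd h.symm writeVar_ne_close
  | cons p l ih =>
    cases l' with
    | nil =>
      rw [List.flatMap_cons, List.append_assoc] at h
      exact absurd h writeVar_ne_close
    | cons q l' =>
      rw [List.flatMap_cons, List.flatMap_cons, List.append_assoc, List.append_assoc] at h
      obtain ⟨hp, h⟩ := writeVar_append_inj h
      obtain ⟨hl, hr⟩ := ih h
      exact ⟨by rw [hp, hl], hr⟩

theorem MDL.Formula.write_append_inj {φ ψ : MDL.Formula} {r r' : List Token}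
    (h : φ.write ++ r = ψ.write ++ r') : φ = ψ ∧ r = r' := by
  induction φ generalizing ψ r r' with
  | pos p | neg p =>
    cases ψ <;> simp [write] at h
    obtain ⟨rfl, rfl⟩ := writeVar_append_inj h
    exact ⟨rfl, rfl⟩
  | dep ps q =>
    cases ψ <;> simp only [write, List.cons_append, List.cons.injEq, reduceCtorEq, false_and,
      true_and, List.append_assoc, List.nil_append] at h
    obtain ⟨h₁, rfl⟩ := writeVars_append_inj h
    obtain ⟨rfl, h₂⟩ := List.append_inj' h₁ rfl
    simpa using h₂
  | conj φ₁ φ₂ ih₁ ih₂ | disj φ₁ φ₂ ih₁ ih₂ =>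
    cases ψ <;> simp only [write, List.cons_append, List.cons.injEq, reduceCtorEq, false_and,
      true_and, List.append_assoc, List.nil_append] at h
    obtain ⟨rfl, h₁⟩ := ih₁ h
    obtain ⟨rfl, h₂⟩ := ih₂ h₁
    simpa using h₂
  | box φ ih | dia φ ih =>
    cases ψ <;> simp only [write, List.cons_append, List.cons.injEq, reduceCtorEq, false_and,
      true_and, List.append_assoc, List.nil_append] at h
    obtain ⟨rfl, h₁⟩ := ih h
    simpa using h₁

theorem QPDL.Formula.write_append_inj {φ ψ : QPDL.Formula} {r r' : List Token}
    (h : φ.write ++ r = ψ.write ++ r') : φ = ψ ∧ r = r' := by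
  induction φ generalizing ψ r r' with
  | pos p | neg p =>
    cases ψ <;> simp [write] at h
    obtain ⟨rfl, rfl⟩ := writeVar_append_inj h
    exact ⟨rfl, rfl⟩
  | dep ps q =>
    cases ψ <;> simp only [write, List.cons_append, List.cons.injEq, reduceCtorEq, false_and,
      true_and, List.append_assoc, List.nil_append] at h
    obtain ⟨h₁, rfl⟩ := writeVars_append_inj h
    obtain ⟨rfl, h₂⟩ := List.append_inj' h₁ rfl
    simpa using h₂
  | conj φ₁ φ₂ ih₁ ih₂ | disj φ₁ φ₂ ih₁ ih₂ =>
    cases ψ <;> simp only [write, List.cons_append, List.cons.injEq, reduceCtorEq, false_and,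
      true_and, List.append_assoc, List.nil_append] at h
    obtain ⟨rfl, h₁⟩ := ih₁ h
    obtain ⟨rfl, h₂⟩ := ih₂ h₁
    simpa using h₂
  | ex p φ ih | all p φ ih =>
    cases ψ <;> simp only [write, List.cons_append, List.cons.injEq, reduceCtorEq, false_and,
      true_and, List.append_assoc, List.nil_append] at h
    obtain ⟨rfl, h₁⟩ := writeVar_append_inj h
    obtain ⟨rfl, h₂⟩ := ih h₁
    simpa using h₂

theorem writeSequent_injective {α : Type} {write : α → List Token}
    (hw : ∀ {x y : α} {r r' : List Token}, write x ++ r = write y ++ r' → x = y ∧ r = r')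
    (ht : ∀ {x : α} {r r' : List Token}, write x ++ r ≠ Token.turnstile :: r') :
    Function.Injective (writeSequent write) := by
  rintro ⟨l, x⟩ ⟨l', y⟩ h
  simp only [writeSequent] at h
  induction l generalizing l' with
  | nil =>
    cases l' with
    | nil =>
      have := hw (x := x) (y := y) (r := []) (r' := []) (by simpa using h)
      rw [this.1]
    | cons b l' =>
      rw [List.flatMap_cons, List.append_assoc] at h
      exact absurd h.symm ht
  | cons a l ih =>
    cases l' with
    | nil =>
      rw [List.flatMap_cons, List.append_assoc] at h
      exact absurd h ht
    | cons b l' =>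
      rw [List.flatMap_cons, List.flatMap_cons, List.append_assoc, List.append_assoc] at h
      obtain ⟨rfl, h₁⟩ := hw h
      have h₂ := ih l' h₁
      simp_all

theorem MDL.Formula.write_ne_turnstile {φ : MDL.Formula} {r r' : List Token} :
    φ.write ++ r ≠ Token.turnstile :: r' := by
  cases φ <;> simp [write]

theorem QPDL.Formula.write_ne_turnstile {φ : QPDL.Formula} {r r' : List Token} :
    φ.write ++ r ≠ Token.turnstile :: r' := by
  cases φ <;> simp [write]

/-- The encoding of MDL formulae. -/
noncomputable def MDL.encFormula : Computability.Encoding MDL.Formula Token :=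
  encodingOfInjective MDL.Formula.write fun φ ψ h =>
    (MDL.Formula.write_append_inj (r := []) (r' := []) (by rw [h])).1

/-- The encoding of entailment instances of MDL. -/
noncomputable def MDL.encSequent : Computability.Encoding (List MDL.Formula × MDL.Formula) Token :=
  encodingOfInjective (writeSequent MDL.Formula.write)
    (writeSequent_injective MDL.Formula.write_append_inj MDL.Formula.write_ne_turnstile)

/-- The encoding of QPDL formulae. -/
noncomputable def QPDL.encFormula : Computability.Encoding QPDL.Formula Token :=
  encodingOfInjective QPDL.Formula.write fun φ ψ h =>
    (QPDL.Formula.write_append_inj (r := []) (r' := []) (by rw [h])).1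

/-- The encoding of entailment instances of QPDL. -/
noncomputable def QPDL.encSequent :
    Computability.Encoding (List QPDL.Formula × QPDL.Formula) Token :=
  encodingOfInjective (writeSequent QPDL.Formula.write)
    (writeSequent_injective QPDL.Formula.write_append_inj QPDL.Formula.write_ne_turnstile)

/-! ### Polynomial-time reductions -/

/-- Polynomial-time many-one reducibility of the decision problem `P` on instances encoded by
`ea` to the decision problem `Q` on instances encoded by `eb`: some function that a Turing
machine computes in polynomial time maps exactly the yes-instances to yes-instances. -/
def PolyTimeReducible {α β Γ Δ : Type} (ea : Computability.Encoding α Γ)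
    (eb : Computability.Encoding β Δ) (P : α → Prop) (Q : β → Prop) : Prop :=
  ∃ f : α → β, Nonempty (Turing.TM2ComputableInPolyTime ea.encode eb.encode f) ∧
    ∀ a, P a ↔ Q (f a)

/-! A quantifier over `p` moves from an assignment to one that differs at most at `p`; a modality
moves from a world to a successor. The reductions therefore confine attention to Kripke models in
which worlds carry assignments and certain successors are exactly the updates of one variable. Then
`ex p φ` becomes a diamond and `all p φ` a box, both restricted to updates of `p` by `isUpdate p`.

The restriction is imposed by a dependence-free formula. Such formulae are flat (`sat_iff_truth`),
so they can be checked world by world, and since satisfaction is downward closed, a disjunction with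
the dual of one of them cuts the team down to the worlds where it is true (`sat_disj_dual`). For
each variable, `updateAxiom p` says that both values of `p` can be reached by an update and that
every successor keeps the value of `p` unless it is a tail world or its label can be read as `p`.
Labels are spelled bit by bit along tail successors, using three auxiliary variables. `isUpdate`
reads them with boxes, the axiom with diamonds, and the two readings can only agree on one name
(`eq_of_labelBox_of_labelDia`). Hence every axiom speaks of a single variable, and no names ever
have to be compared when the axioms are written down.

If the axioms for all occurring variables hold to the quantifier depth, a team of worlds and a team
of assignments that realize the same values satisfy corresponding formulae (`sat_toMDL`). Every team
of worlds has a matching propositional team, and every propositional team is matched in the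
canonical update frame, where all axioms are true. So it suffices to conjoin the axioms for
satisfiability, to disjoin their dual for validity, and to add them as a premise for entailment.

For the complexity bound, a small language of stack programs is compiled to Turing machines
(`polyTime`). The translation works symbol by symbol, apart from the name after a quantifier, and
dualization merely exchanges symbols (`write_dual`), so one program scheme, `reduction`, serves all
three problems. The axioms are written for every name in the input and nested as deep as the input
is long, which exceeds what is needed but avoids any computation of depth. -/

/-! ### Dependence-free formulae and their pointwise semantics -/

namespace MDL

/-- The negation normal form of the negation of a dependence-free formula. -/
def Formula.dual : Formula → Formula
  | pos p => neg p
  | neg p => pos p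
  | dep ps q => dep ps q
  | conj φ ψ => disj φ.dual ψ.dual
  | disj φ ψ => conj φ.dual ψ.dual
  | box φ => dia φ.dual
  | dia φ => box φ.dual

/-- The formula contains no dependence atom. -/
def Formula.DepFree : Formula → Prop
  | pos _ => True
  | neg _ => True
  | dep _ _ => False
  | conj φ ψ => φ.DepFree ∧ ψ.DepFree
  | disj φ ψ => φ.DepFree ∧ ψ.DepFree
  | box φ => φ.DepFree
  | dia φ => φ.DepFree

theorem Formula.DepFree.dual {φ : Formula} (h : φ.DepFree) : φ.dual.DepFree := by
  induction φ <;> simp_all [Formula.dual, DepFree]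

namespace KripkeModel

variable {V : Set PropVar} (M : KripkeModel.{u} V)

/-- Truth of a dependence-free formula at a world. -/
def Truth {V : Set PropVar} (M : KripkeModel.{u} V) : M.W → Formula → Prop
  | w, .pos p => w ∈ M.truthSet p
  | w, .neg p => w ∉ M.truthSet p
  | _, .dep _ _ => True
  | w, .conj φ ψ => Truth M w φ ∧ Truth M w ψ
  | w, .disj φ ψ => Truth M w φ ∨ Truth M w ψ
  | w, .box φ => ∀ w', M.R w w' → Truth M w' φ
  | w, .dia φ => ∃ w', M.R w w' ∧ Truth M w' φ

/-- Dependence-free formulae are flat. -/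
theorem sat_iff_truth {φ : Formula} (hφ : φ.DepFree) (T : Set M.W) :
    M.Sat T φ ↔ ∀ w ∈ T, M.Truth w φ := by
  induction φ generalizing T with
  | pos p => rfl
  | neg p => simp [Sat, Truth, Set.eq_empty_iff_forall_notMem]
  | dep ps q => exact hφ.elim
  | conj φ ψ ih₁ ih₂ =>
    simp only [Sat, Truth, ih₁ hφ.1, ih₂ hφ.2]
    exact ⟨fun h w hw => ⟨h.1 w hw, h.2 w hw⟩, fun h => ⟨fun w hw => (h w hw).1,
      fun w hw => (h w hw).2⟩⟩
  | disj φ ψ ih₁ ih₂ =>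
    simp only [Sat, Truth, ih₁ hφ.1, ih₂ hφ.2]
    constructor
    · rintro ⟨T₁, T₂, rfl, h₁, h₂⟩ w (hw | hw)
      exacts [.inl (h₁ w hw), .inr (h₂ w hw)]
    · intro h
      refine ⟨{w ∈ T | M.Truth w φ}, {w ∈ T | M.Truth w ψ}, ?_, fun w hw => hw.2, fun w hw => hw.2⟩
      ext w
      constructor
      · rintro (hw | hw) <;> exact hw.1
      · exact fun hw => (h w hw).imp (⟨hw, ·⟩) (⟨hw, ·⟩)
  | box φ ih =>
    simp only [Sat, Truth, ih hφ, successors]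
    exact ⟨fun h w hw w' hr => h w' ⟨w, hw, hr⟩, fun h w' ⟨w, hw, hr⟩ => h w hw w' hr⟩
  | dia φ ih =>
    simp only [Sat, Truth, ih hφ]
    constructor
    · rintro ⟨T', ⟨-, hT'⟩, h⟩ w hw
      obtain ⟨w', hw', hr⟩ := hT' w hw
      exact ⟨w', hr, h w' hw'⟩
    · intro h
      refine ⟨{w' ∈ M.successors T | M.Truth w' φ}, ⟨fun w' hw' => hw'.1, fun w hw => ?_⟩,
        fun w' hw' => hw'.2⟩
      obtain ⟨w', hr, hw'⟩ := h w hw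
      exact ⟨w', ⟨⟨w, hw, hr⟩, hw'⟩, hr⟩

theorem truth_dual {φ : Formula} (hφ : φ.DepFree) (w : M.W) :
    M.Truth w φ.dual ↔ ¬ M.Truth w φ := by
  induction φ generalizing w with
  | dep ps q => exact hφ.elim
  | _ => simp_all [Truth, Formula.dual, Formula.DepFree, imp_iff_not_or]

/-- Satisfaction is downward closed. -/
theorem Sat.mono {φ : Formula} {T T' : Set M.W} (h : M.Sat T φ) (hT : T' ⊆ T) : M.Sat T' φ := by
  induction φ generalizing T T' with
  | pos p => exact hT.trans h
  | neg p =>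
    simp only [Sat, Set.eq_empty_iff_forall_notMem] at h ⊢
    exact fun w hw => h w ⟨hT hw.1, hw.2⟩
  | dep ps q => exact fun w hw w' hw' => h w (hT hw) w' (hT hw')
  | conj φ ψ ih₁ ih₂ => exact ⟨ih₁ h.1 hT, ih₂ h.2 hT⟩
  | disj φ ψ ih₁ ih₂ =>
    obtain ⟨T₁, T₂, rfl, h₁, h₂⟩ := h
    refine ⟨T₁ ∩ T', T₂ ∩ T', ?_, ih₁ h₁ Set.inter_subset_left, ih₂ h₂ Set.inter_subset_left⟩
    rw [← Set.union_inter_distrib_right, Set.inter_eq_right.2 hT]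
  | box φ ih => exact ih (T := M.successors T) h fun w ⟨w', hw', hr⟩ => ⟨w', hT hw', hr⟩
  | dia φ ih =>
    obtain ⟨U, ⟨hU, hU'⟩, h⟩ := h
    refine ⟨U ∩ M.successors T', ⟨Set.inter_subset_right, fun w hw => ?_⟩,
      ih h Set.inter_subset_left⟩
    obtain ⟨w', hw', hr⟩ := hU' w (hT hw)
    exact ⟨w', ⟨hw', w, hw, hr⟩, hr⟩

/-- A disjunction with a dual relativizes the other disjunct. -/
theorem sat_disj_dual {φ ψ : Formula} (hφ : φ.DepFree) (T : Set M.W) :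
    M.Sat T (.disj φ.dual ψ) ↔ M.Sat {w ∈ T | M.Truth w φ} ψ := by
  simp only [Sat, M.sat_iff_truth hφ.dual, M.truth_dual hφ]
  constructor
  · rintro ⟨T₁, T₂, rfl, h₁, h₂⟩
    -- Worlds where `φ` is true cannot lie in `T₁`, so they all lie in `T₂`; downward closure does
    -- the rest.
    exact h₂.mono _ fun w hw => hw.1.resolve_left fun hw' => h₁ w hw' hw.2
  · refine fun h => ⟨{w ∈ T | ¬ M.Truth w φ}, _, ?_, fun w hw => hw.2, h⟩
    ext w
    by_cases hw : M.Truth w φ <;> simp [hw]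

end KripkeModel

/-! ### The axioms of update frames -/

namespace Formula

/-- The variable of MDL that stands for the variable `p` of QPDL. -/
def copyVar (p : PropVar) : PropVar := p ++ [true]

/-- The label of the world is not empty. -/
def moreVar : PropVar := []

/-- The first bit of the label of the world. -/
def bitVar : PropVar := [false]

/-- The world carries the tail of the label of its predecessors. -/
def tailVar : PropVar := [false, false]

/-- The literal `p` or `¬ p`. -/
def literal : Bool → PropVar → Formula
  | true, p => pos p
  | false, p => neg p

/-- A formula that all teams satisfy. -/
def top : Formula := disj (pos moreVar) (neg moreVar)

/-- The label is `p` when it is read along any of the tail successors. -/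
def labelBox : PropVar → Formula
  | [] => neg moreVar
  | b :: p => conj (pos moreVar) (conj (literal b bitVar) (box (disj (neg tailVar) (labelBox p))))

/-- The label is `p` when it is read along some of the tail successors. -/
def labelDia : PropVar → Formula
  | [] => neg moreVar
  | b :: p => conj (pos moreVar) (conj (literal b bitVar) (dia (conj (pos tailVar) (labelDia p))))

/-- The world results from its predecessor by an update of the variable `p`. -/
def isUpdate (p : PropVar) : Formula := conj (neg tailVar) (labelBox p)

/-- The variable `p` has the value `b`, and keeps it unless it is updated. -/
def keepsValue (b : Bool) (p : PropVar) : Formula :=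
  conj (literal b (copyVar p))
    (box (disj (literal b (copyVar p)) (disj (pos tailVar) (labelDia p))))

/-- Some update of the variable `p` gives it the value `b`. -/
def hasUpdate (b : Bool) (p : PropVar) : Formula :=
  dia (conj (isUpdate p) (literal b (copyVar p)))

/-- The variable `p` can be updated to both values, and no other updates affect it. -/
def updateAxiom (p : PropVar) : Formula :=
  conj (disj (keepsValue true p) (keepsValue false p)) (conj (hasUpdate true p) (hasUpdate false p))

/-- The update axioms of a list of variables. -/
def updateAxioms : List PropVar → Formula
  | [] => top
  | p :: ps => conj (updateAxiom p) (updateAxioms ps)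

/-- `φ` holds at all worlds reachable in less than `n` steps. -/
def globally (φ : Formula) : ℕ → Formula
  | 0 => top
  | n + 1 => conj φ (box (globally φ n))

theorem literal_depFree (b : Bool) (p : PropVar) : (literal b p).DepFree := by
  cases b <;> trivial

theorem labelBox_depFree (p : PropVar) : (labelBox p).DepFree := by
  induction p <;> simp_all [labelBox, DepFree, literal_depFree]

theorem labelDia_depFree (p : PropVar) : (labelDia p).DepFree := by
  induction p <;> simp_all [labelDia, DepFree, literal_depFree]

theorem isUpdate_depFree (p : PropVar) : (isUpdate p).DepFree :=
  ⟨trivial, labelBox_depFree p⟩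

theorem updateAxiom_depFree (p : PropVar) : (updateAxiom p).DepFree := by
  simp [updateAxiom, keepsValue, hasUpdate, DepFree, literal_depFree, labelDia_depFree,
    isUpdate_depFree]

theorem updateAxioms_depFree (ps : List PropVar) : (updateAxioms ps).DepFree := by
  induction ps <;> simp_all [updateAxioms, top, DepFree, updateAxiom_depFree]

theorem globally_depFree {φ : Formula} (h : φ.DepFree) (n : ℕ) : (globally φ n).DepFree := by
  induction n <;> simp_all [globally, top, DepFree]

end Formula

namespace KripkeModel

open Formula

variable {V : Set PropVar} (M : KripkeModel.{u} V)

theorem sat_top (T : Set M.W) : M.Sat T top :=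
  (M.sat_iff_truth (φ := top) ⟨trivial, trivial⟩ T).2 fun _ _ => em _

theorem truth_literal (w : M.W) (b : Bool) (p : PropVar) :
    M.Truth w (literal b p) ↔ (w ∈ M.truthSet p ↔ b = true) := by
  cases b <;> simp [literal, Truth]

/-- The tail successor that witnesses the diamond is also seen by the box, so the two readings
follow a common path and agree bit by bit. Neither reading alone is unique in an arbitrary model:
boxes may be vacuous, and diamonds may have several witnesses. -/
theorem eq_of_labelBox_of_labelDia {w : M.W} {p q : PropVar} (hp : M.Truth w (labelBox p))
    (hq : M.Truth w (labelDia q)) : p = q := by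
  induction p generalizing w q with
  | nil =>
    cases q with
    | nil => rfl
    | cons b q => exact absurd hq.1 hp
  | cons a p ih =>
    cases q with
    | nil => exact absurd hp.1 hq
    | cons b q =>
      obtain ⟨-, ha, hp⟩ := hp
      obtain ⟨-, hb, w', hr, ht, hq⟩ := hq
      rw [truth_literal] at ha hb
      rw [ih ((hp w' hr).resolve_left (not_not_intro ht)) hq, Bool.eq_iff_iff.2 (ha.symm.trans hb)]

theorem truth_updateAxioms {w : M.W} {ps : List PropVar} :
    M.Truth w (updateAxioms ps) ↔ ∀ p ∈ ps, M.Truth w (updateAxiom p) := by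
  induction ps with
  | nil => simp [updateAxioms, top, Truth, em]
  | cons p ps ih => simp [updateAxioms, Truth, ih]

theorem truth_globally_of_forall {φ : Formula} (h : ∀ w, M.Truth w φ) (n : ℕ) (w : M.W) :
    M.Truth w (globally φ n) := by
  induction n generalizing w with
  | zero => exact em _
  | succ n ih => exact ⟨h w, fun w' _ => ih w'⟩

theorem exists_update {w : M.W} {p : PropVar} (h : M.Truth w (updateAxiom p)) (b : Bool) :
    ∃ w', M.R w w' ∧ M.Truth w' (isUpdate p) ∧ (w' ∈ M.truthSet (copyVar p) ↔ b = true) := by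
  obtain ⟨-, ht, hf⟩ := h
  have hb : M.Truth w (hasUpdate b p) := by cases b <;> assumption
  obtain ⟨w', hr, hu, hl⟩ := hb
  exact ⟨w', hr, hu, (M.truth_literal _ _ _).1 hl⟩

/-- Of the three ways in which a successor can satisfy the axiom for `q`, being a tail world
contradicts `isUpdate p`, and a label readable as `q` would force `q = p`. Only keeping the value
remains. -/
theorem mem_truthSet_iff_of_update {w w' : M.W} {p q : PropVar} (h : M.Truth w (updateAxiom q))
    (hr : M.R w w') (hu : M.Truth w' (isUpdate p)) (hpq : q ≠ p) :
    w' ∈ M.truthSet (copyVar q) ↔ w ∈ M.truthSet (copyVar q) := by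
  have key : ∀ b, M.Truth w (keepsValue b q) →
      (w' ∈ M.truthSet (copyVar q) ↔ w ∈ M.truthSet (copyVar q)) := by
    rintro b ⟨hl, hk⟩
    rcases hk w' hr with h' | h' | h'
    · rw [truth_literal] at hl h'
      rw [hl, h']
    · exact absurd h' hu.1
    · exact absurd (M.eq_of_labelBox_of_labelDia hu.2 h').symm hpq
  exact h.1.elim (key _) (key _)

end KripkeModel

end MDL

/-! ### The translation -/

namespace QPDL

open MDL.Formula (copyVar isUpdate updateAxioms updateAxiom globally top)

/-- The translation of QPDL into MDL. -/
def Formula.toMDL : Formula → MDL.Formula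
  | pos p => .pos (copyVar p)
  | neg p => .neg (copyVar p)
  | dep ps q => .conj top (.dep (ps.map copyVar) (copyVar q))
  | conj φ ψ => .conj top (.conj φ.toMDL ψ.toMDL)
  | disj φ ψ => .conj top (.disj φ.toMDL ψ.toMDL)
  | ex p φ => .dia (.conj (isUpdate p) φ.toMDL)
  | all p φ => .box (.disj (isUpdate p).dual φ.toMDL)

/-- The nesting depth of the quantifiers. -/
def Formula.depth : Formula → ℕ
  | pos _ => 0
  | neg _ => 0
  | dep _ _ => 0
  | conj φ ψ => max φ.depth ψ.depth
  | disj φ ψ => max φ.depth ψ.depth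
  | ex _ φ => φ.depth + 1
  | all _ φ => φ.depth + 1

/-- The occurrences of variables, from left to right. -/
def Formula.occ : Formula → List PropVar
  | pos p => [p]
  | neg p => [p]
  | dep ps q => ps ++ [q]
  | conj φ ψ => φ.occ ++ ψ.occ
  | disj φ ψ => φ.occ ++ ψ.occ
  | ex p φ => p :: φ.occ
  | all p φ => p :: φ.occ

theorem Assignment.holds_update {V : Set PropVar} (s : Assignment V) (p q : PropVar) (a : Bool) :
    (s.update p a).Holds q ↔ if q = p then a = true else s.Holds q := by
  unfold Holds update
  by_cases h : q = p <;> simp [h]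

section

variable {U V : Set PropVar} {V' : Set PropVar} (M : MDL.KripkeModel.{u} V')

/-- The assignment `s` and the world `w` agree on the variables in `U`. -/
def Agree (U : Set PropVar) (s : Assignment V) (w : M.W) : Prop :=
  ∀ p ∈ U, s.Holds p ↔ w ∈ M.truthSet (copyVar p)

/-- The teams `X` and `T` contain the same assignments to the variables in `U`. -/
def TeamAgree (U : Set PropVar) (X : Team V) (T : Set M.W) : Prop :=
  (∀ s ∈ X, ∃ w ∈ T, Agree M U s w) ∧ ∀ w ∈ T, ∃ s ∈ X, Agree M U s w

variable {M}

/-- One quantifier step matches one modal step: the new value agrees at `p` by `ha`, and the axioms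
preserve all other variables in `U`. -/
theorem Agree.update {s : Assignment V} {w w' : M.W} {p : PropVar} {a : Bool}
    (h : Agree M U s w) (hw : ∀ q ∈ U, M.Truth w (updateAxiom q)) (hr : M.R w w')
    (hu : M.Truth w' (isUpdate p)) (ha : w' ∈ M.truthSet (copyVar p) ↔ a = true) :
    Agree M U (s.update p a) w' := by
  intro q hq
  rw [Assignment.holds_update]
  split_ifs with hqp
  · rw [hqp, ha]
  · rw [h q hq, M.mem_truthSet_iff_of_update (hw q hq) hr hu hqp]

/-- In update frames, the translation preserves satisfaction. -/
theorem sat_toMDL {ps : List PropVar} {φ : Formula} {n : ℕ} {X : Team V} {T : Set M.W}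
    (hps : ∀ p ∈ φ.occ, p ∈ ps) (hn : φ.depth ≤ n) (hXT : TeamAgree M {p | p ∈ ps} X T)
    (hT : ∀ w ∈ T, M.Truth w (globally (updateAxioms ps) n)) :
    M.Sat T φ.toMDL ↔ Sat V X φ := by
  -- Each quantifier uses up one level of the axioms, which is why `n` is generalized in the
  -- induction.
  have step : ∀ {n w}, M.Truth w (globally (updateAxioms ps) (n + 1)) →
      (∀ q ∈ ps, M.Truth w (updateAxiom q)) ∧
      ∀ w', M.R w w' → M.Truth w' (globally (updateAxioms ps) n) :=
    fun h => ⟨M.truth_updateAxioms.1 h.1, h.2⟩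
  induction φ generalizing V n T with
  | pos p =>
    have hp : p ∈ ps := hps p (by simp [Formula.occ])
    constructor
    · intro h s hs
      obtain ⟨w, hw, hsw⟩ := hXT.1 s hs
      exact (hsw p hp).2 (h hw)
    · intro h w hw
      obtain ⟨s, hs, hsw⟩ := hXT.2 w hw
      exact (hsw p hp).1 (h s hs)
  | neg p =>
    have hp : p ∈ ps := hps p (by simp [Formula.occ])
    simp only [Formula.toMDL, MDL.KripkeModel.Sat, Set.eq_empty_iff_forall_notMem]
    constructor
    · intro h s hs hsp
      obtain ⟨w, hw, hsw⟩ := hXT.1 s hs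
      exact h w ⟨hw, (hsw p hp).1 hsp⟩
    · rintro h w ⟨hw, hwp⟩
      obtain ⟨s, hs, hsw⟩ := hXT.2 w hw
      exact h s hs ((hsw p hp).2 hwp)
  | dep qs q =>
    have hqs : ∀ p ∈ qs, p ∈ ps := fun p hp => hps p (by simp [Formula.occ, hp])
    have hq : q ∈ ps := hps q (by simp [Formula.occ])
    refine (and_iff_right (M.sat_top T)).trans ?_
    constructor
    · intro h s hs s' hs' hss
      obtain ⟨w, hw, hsw⟩ := hXT.1 s hs
      obtain ⟨w', hw', hsw'⟩ := hXT.1 s' hs'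
      rw [hsw q hq, hsw' q hq]
      refine h w hw w' hw' fun r hr => ?_
      obtain ⟨p, hp, rfl⟩ := List.mem_map.1 hr
      rw [← hsw p (hqs p hp), ← hsw' p (hqs p hp), hss p hp]
    · intro h w hw w' hw' hww
      obtain ⟨s, hs, hsw⟩ := hXT.2 w hw
      obtain ⟨s', hs', hsw'⟩ := hXT.2 w' hw'
      rw [← hsw q hq, ← hsw' q hq]
      refine h s hs s' hs' fun p hp => ?_
      rw [hsw p (hqs p hp), hsw' p (hqs p hp), hww _ (List.mem_map_of_mem hp)]
  | conj φ ψ ih₁ ih₂ =>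
    have h₁ := ih₁ (fun p hp => hps p (List.mem_append_left _ hp)) ((le_max_left _ _).trans hn)
      hXT hT
    have h₂ := ih₂ (fun p hp => hps p (List.mem_append_right _ hp)) ((le_max_right _ _).trans hn)
      hXT hT
    exact (and_iff_right (M.sat_top T)).trans (and_congr h₁ h₂)
  | disj φ ψ ih₁ ih₂ =>
    replace ih₁ := fun X T => @ih₁ V n X T (fun p hp => hps p (List.mem_append_left _ hp))
      ((le_max_left _ _).trans hn)
    replace ih₂ := fun X T => @ih₂ V n X T (fun p hp => hps p (List.mem_append_right _ hp))
      ((le_max_right _ _).trans hn)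
    refine (and_iff_right (M.sat_top T)).trans ?_
    constructor
    · rintro ⟨T₁, T₂, rfl, h₁, h₂⟩
      -- A splitting is transported along agreement. An assignment realized in both parts goes to
      -- both; the parts need not be disjoint.
      refine ⟨{s ∈ X | ∃ w ∈ T₁, Agree M {p | p ∈ ps} s w},
        {s ∈ X | ∃ w ∈ T₂, Agree M {p | p ∈ ps} s w}, ?_, ?_, ?_⟩
      · ext s
        constructor
        · rintro (h | h) <;> exact h.1
        · intro hs
          obtain ⟨w, hw | hw, hsw⟩ := hXT.1 s hs
          exacts [.inl ⟨hs, w, hw, hsw⟩, .inr ⟨hs, w, hw, hsw⟩]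
      · refine (ih₁ _ _ ⟨fun s hs => hs.2, fun w hw => ?_⟩ fun w hw => hT w (.inl hw)).1 h₁
        obtain ⟨s, hs, hsw⟩ := hXT.2 w (.inl hw)
        exact ⟨s, ⟨hs, w, hw, hsw⟩, hsw⟩
      · refine (ih₂ _ _ ⟨fun s hs => hs.2, fun w hw => ?_⟩ fun w hw => hT w (.inr hw)).1 h₂
        obtain ⟨s, hs, hsw⟩ := hXT.2 w (.inr hw)
        exact ⟨s, ⟨hs, w, hw, hsw⟩, hsw⟩
    · rintro ⟨X₁, X₂, rfl, h₁, h₂⟩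
      refine ⟨{w ∈ T | ∃ s ∈ X₁, Agree M {p | p ∈ ps} s w},
        {w ∈ T | ∃ s ∈ X₂, Agree M {p | p ∈ ps} s w}, ?_, ?_, ?_⟩
      · ext w
        constructor
        · rintro (h | h) <;> exact h.1
        · intro hw
          obtain ⟨s, hs | hs, hsw⟩ := hXT.2 w hw
          exacts [.inl ⟨hw, s, hs, hsw⟩, .inr ⟨hw, s, hs, hsw⟩]
      · refine (ih₁ _ _ ⟨fun s hs => ?_, fun w hw => hw.2⟩ fun w hw => hT w hw.1).2 h₁
        obtain ⟨w, hw, hsw⟩ := hXT.1 s (.inl hs)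
        exact ⟨w, ⟨hw, s, hs, hsw⟩, hsw⟩
      · refine (ih₂ _ _ ⟨fun s hs => ?_, fun w hw => hw.2⟩ fun w hw => hT w hw.1).2 h₂
        obtain ⟨w, hw, hsw⟩ := hXT.1 s (.inr hs)
        exact ⟨w, ⟨hw, s, hs, hsw⟩, hsw⟩
  | ex p φ ih =>
    obtain ⟨n, rfl⟩ : ∃ m, n = m + 1 := ⟨n - 1, by simp only [Formula.depth] at hn; omega⟩
    replace ih := fun X T => @ih (insert p V) n X T
      (fun q hq => hps q (List.mem_cons_of_mem _ hq)) (Nat.le_of_succ_le_succ hn)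
    have hp : p ∈ ps := hps p (by simp [Formula.occ])
    constructor
    · rintro ⟨T', ⟨hT'₁, hT'₂⟩, hu, h⟩
      rw [M.sat_iff_truth (MDL.Formula.isUpdate_depFree p)] at hu
      -- Several worlds may realize the same assignment and have successors in `T'` with different
      -- values of `p`. Lax semantics allows all these values to be collected.
      refine ⟨fun s => {a | ∃ w ∈ T, Agree M {p | p ∈ ps} s.1 w ∧ ∃ w' ∈ T', M.R w w' ∧
        (w' ∈ M.truthSet (copyVar p) ↔ a = true)}, fun s => ?_, (ih _ _ ⟨?_, ?_⟩ ?_).1 h⟩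
      · obtain ⟨w, hw, hsw⟩ := hXT.1 s.1 s.2
        obtain ⟨w', hw', hr⟩ := hT'₂ w hw
        classical
        exact ⟨decide (w' ∈ M.truthSet (copyVar p)), w, hw, hsw, w', hw', hr, by simp⟩
      · rintro _ ⟨s, a, ⟨w, hw, hsw, w', hw', hr, ha⟩, rfl⟩
        exact ⟨w', hw', hsw.update (step (hT w hw)).1 hr (hu w' hw') ha⟩
      · intro w' hw'
        obtain ⟨w, hw, hr⟩ := hT'₁ hw'
        obtain ⟨s, hs, hsw⟩ := hXT.2 w hw
        classical
        have ha : w' ∈ M.truthSet (copyVar p) ↔ decide (w' ∈ M.truthSet (copyVar p)) = true := by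
          simp
        exact ⟨_, ⟨⟨s, hs⟩, _, ⟨w, hw, hsw, w', hw', hr, ha⟩, rfl⟩,
          hsw.update (step (hT w hw)).1 hr (hu w' hw') ha⟩
      · intro w' hw'
        obtain ⟨w, hw, hr⟩ := hT'₁ hw'
        exact (step (hT w hw)).2 w' hr
    · rintro ⟨F, hF, h⟩
      -- The largest possible choice: all updates of `p` whose new value `F` permits for some
      -- assignment agreeing with the predecessor.
      refine ⟨{w' | ∃ w ∈ T, M.R w w' ∧ M.Truth w' (isUpdate p) ∧ ∃ s : X,
        Agree M {p | p ∈ ps} s.1 w ∧ ∃ a ∈ F s, (w' ∈ M.truthSet (copyVar p) ↔ a = true)},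
        ⟨fun w' ⟨w, hw, hr, _⟩ => ⟨w, hw, hr⟩, fun w hw => ?_⟩,
        (M.sat_iff_truth (MDL.Formula.isUpdate_depFree p) _).2 fun w' ⟨_, _, _, hu, _⟩ => hu,
        (ih _ _ ⟨?_, ?_⟩ ?_).2 h⟩
      · obtain ⟨s, hs, hsw⟩ := hXT.2 w hw
        obtain ⟨a, ha⟩ := hF ⟨s, hs⟩
        obtain ⟨w', hr, hu, hw'⟩ := M.exists_update ((step (hT w hw)).1 p hp) a
        exact ⟨w', ⟨w, hw, hr, hu, ⟨s, hs⟩, hsw, a, ha, hw'⟩, hr⟩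
      · rintro _ ⟨s, a, ha, rfl⟩
        obtain ⟨w, hw, hsw⟩ := hXT.1 s.1 s.2
        obtain ⟨w', hr, hu, hw'⟩ := M.exists_update ((step (hT w hw)).1 p hp) a
        exact ⟨w', ⟨w, hw, hr, hu, s, hsw, a, ha, hw'⟩, hsw.update (step (hT w hw)).1 hr hu hw'⟩
      · rintro w' ⟨w, hw, hr, hu, s, hsw, a, ha, hw'⟩
        exact ⟨_, ⟨s, a, ha, rfl⟩, hsw.update (step (hT w hw)).1 hr hu hw'⟩
      · rintro w' ⟨w, hw, hr, -⟩
        exact (step (hT w hw)).2 w' hr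
  | all p φ ih =>
    obtain ⟨n, rfl⟩ : ∃ m, n = m + 1 := ⟨n - 1, by simp only [Formula.depth] at hn; omega⟩
    have hp : p ∈ ps := hps p (by simp [Formula.occ])
    -- The disjunct `(isUpdate p).dual` discards the successors that are not updates of `p`; those
    -- left match the duplicated team.
    refine (M.sat_disj_dual (MDL.Formula.isUpdate_depFree p) _).trans
      (ih (fun q hq => hps q (List.mem_cons_of_mem _ hq)) (Nat.le_of_succ_le_succ hn) ⟨?_, ?_⟩ ?_)
    · rintro _ ⟨s, hs, a, rfl⟩
      obtain ⟨w, hw, hsw⟩ := hXT.1 s hs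
      obtain ⟨w', hr, hu, hw'⟩ := M.exists_update ((step (hT w hw)).1 p hp) a
      exact ⟨w', ⟨⟨w, hw, hr⟩, hu⟩, hsw.update (step (hT w hw)).1 hr hu hw'⟩
    · rintro w' ⟨⟨w, hw, hr⟩, hu⟩
      obtain ⟨s, hs, hsw⟩ := hXT.2 w hw
      classical
      exact ⟨_, ⟨s, hs, _, rfl⟩, hsw.update (step (hT w hw)).1 hr hu
        (a := decide (w' ∈ M.truthSet (copyVar p))) (by simp)⟩
    · rintro w' ⟨⟨w, hw, hr⟩, -⟩
      exact (step (hT w hw)).2 w' hr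

/-- The team of the assignments that the worlds of `T` realize. -/
def teamOf (T : Set M.W) : Team Set.univ :=
  {s | ∃ w ∈ T, Agree M Set.univ s w}

theorem teamAgree_teamOf (T : Set M.W) (U : Set PropVar) : TeamAgree M U (teamOf T) T := by
  classical
  refine ⟨fun s ⟨w, hw, h⟩ => ⟨w, hw, fun p _ => h p trivial⟩, fun w hw => ?_⟩
  have h : Agree M Set.univ
      (fun p : (Set.univ : Set PropVar) => decide (w ∈ M.truthSet (copyVar p.1))) w := by
    intro p _
    simp [Assignment.Holds]
  exact ⟨_, ⟨w, hw, h⟩, fun p _ => h p trivial⟩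

end

end QPDL

/-! ### The canonical update frame -/

namespace MDL

open Formula

/-- The worlds of the canonical update frame. -/
structure UpdateWorld : Type u where
  val : PropVar → Prop
  label : PropVar
  isTail : Bool

namespace UpdateWorld

/-- The truth value of a variable at a world of the canonical update frame. -/
def Holds (w : UpdateWorld.{u}) (p : PropVar) : Prop :=
  (p = moreVar ∧ w.label ≠ []) ∨ (p = bitVar ∧ w.label.head? = some true) ∨
    (p = tailVar ∧ w.isTail = true) ∨ ∃ q, p = copyVar q ∧ w.val q

/-- The accessibility relation of the canonical update frame: the value of the variable named by
the label of the new world is updated, or the first bit of the label is removed. -/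
def Rel (w w' : UpdateWorld.{u}) : Prop :=
  (w'.isTail = false ∧ ∀ q, q ≠ w'.label → (w'.val q ↔ w.val q)) ∨
    (w'.isTail = true ∧ ∃ b, w.label = b :: w'.label)

/-- The canonical update frame. -/
@[reducible] def frame : KripkeModel.{u} Set.univ where
  W := UpdateWorld.{u}
  nonempty := ⟨⟨fun _ => False, [], false⟩⟩
  R w w' := w.Rel w'
  π p := {w | w.Holds p.1}

variable (w : UpdateWorld.{u})

theorem truthSet_frame (p : PropVar) : frame.truthSet p = {w | w.Holds p} :=
  Set.ext fun _ => ⟨fun ⟨_, h⟩ => h, fun h => ⟨trivial, h⟩⟩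

theorem holds_moreVar : w.Holds moreVar ↔ w.label ≠ [] := by
  simp [Holds, moreVar, bitVar, tailVar, copyVar]

theorem holds_bitVar : w.Holds bitVar ↔ w.label.head? = some true := by
  -- Names of copies end in `true`, those of the auxiliary variables do not, so they never clash.
  have h : ∀ q : PropVar, [false] ≠ q ++ [true] := fun q h => by
    simpa using congrArg List.getLast? h
  simp [Holds, moreVar, bitVar, tailVar, copyVar, h]

theorem holds_tailVar : w.Holds tailVar ↔ w.isTail = true := by
  have h : ∀ q : PropVar, [false, false] ≠ q ++ [true] := fun q h => by
    simpa using congrArg List.getLast? h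
  simp [Holds, moreVar, bitVar, tailVar, copyVar, h]

theorem holds_copyVar (p : PropVar) : w.Holds (copyVar p) ↔ w.val p := by
  have h₁ : p ++ [true] ≠ [false] := fun h => by simpa using congrArg List.getLast? h
  have h₂ : p ++ [true] ≠ [false, false] := fun h => by simpa using congrArg List.getLast? h
  simp [Holds, moreVar, bitVar, tailVar, copyVar, h₁, h₂]

theorem truth_pos (p : PropVar) : frame.Truth w (.pos p) ↔ w.Holds p := by
  rw [KripkeModel.Truth, truthSet_frame]; rfl

theorem truth_neg (p : PropVar) : frame.Truth w (.neg p) ↔ ¬ w.Holds p := by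
  rw [KripkeModel.Truth, truthSet_frame]; rfl

theorem truth_literal (b : Bool) (p : PropVar) :
    frame.Truth w (literal b p) ↔ (w.Holds p ↔ b = true) := by
  rw [KripkeModel.truth_literal, truthSet_frame]; rfl

theorem truth_labelBox (p : PropVar) : frame.Truth w (labelBox p) ↔ w.label = p := by
  induction p generalizing w with
  | nil => rw [labelBox, truth_neg, holds_moreVar, not_not]
  | cons b p ih =>
    obtain ⟨s, l, t⟩ := w
    rw [labelBox, KripkeModel.Truth, truth_pos, holds_moreVar, KripkeModel.Truth, truth_literal,
      holds_bitVar]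
    constructor
    · rintro ⟨hl, hb, h⟩
      cases l with
      | nil => exact absurd rfl hl
      | cons a l =>
        -- The frame has a tail successor for every non-empty label, so the box is not vacuous.
        have hp := (h ⟨s, l, true⟩ (.inr ⟨rfl, a, rfl⟩)).resolve_left fun h => by
          rw [truth_neg, holds_tailVar] at h
          exact h rfl
        rw [ih] at hp
        have hab : a = b := Bool.eq_iff_iff.2 (by simpa using hb)
        subst hp hab
        rfl
    · rintro rfl
      refine ⟨by simp, by simp, ?_⟩
      rintro ⟨s', l', t'⟩ (⟨h, -⟩ | ⟨-, a, h⟩)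
      · exact .inl (by rw [truth_neg, holds_tailVar]; simpa using h)
      · exact .inr ((ih _).2 (List.cons.inj h).2.symm)

theorem truth_labelDia : frame.Truth w (labelDia w.label) := by
  obtain ⟨s, p, t⟩ := w
  induction p generalizing t with
  | nil => rw [labelDia, truth_neg, holds_moreVar, not_not]
  | cons b p ih =>
    refine ⟨(truth_pos _ _).2 ((holds_moreVar _).2 (by simp)), (truth_literal _ _ _).2 ?_,
      ⟨s, p, true⟩, .inr ⟨rfl, b, rfl⟩, (truth_pos _ _).2 ((holds_tailVar _).2 rfl), ih true⟩
    simp [holds_bitVar]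

/-- A successor either is a tail world or changes at most the variable named by its label. If that
variable is `p`, the label can be read as `p`; otherwise the value of `p` is kept. Both values are
available because the frame contains every valuation with every label. -/
theorem truth_updateAxiom (p : PropVar) : frame.Truth w (updateAxiom p) := by
  classical
  have keeps : ∀ b, (w.val p ↔ b = true) → frame.Truth w (keepsValue b p) := by
    intro b hb
    refine ⟨by rwa [truth_literal, holds_copyVar], ?_⟩
    rintro w' (⟨ht, h⟩ | ⟨ht, -⟩)
    · by_cases hl : p = w'.label
      · rw [hl]
        exact .inr (.inr (truth_labelDia _))
      · exact .inl (by rwa [truth_literal, holds_copyVar, h p hl])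
    · exact .inr (.inl ((truth_pos _ _).2 ((holds_tailVar _).2 ht)))
  have has : ∀ b, frame.Truth w (hasUpdate b p) := by
    intro b
    refine ⟨⟨Function.update w.val p (b = true), p, false⟩, .inl ⟨rfl, fun q hq => ?_⟩,
      ⟨?_, ?_⟩, ?_⟩
    · simp [Function.update_of_ne hq]
    · simp [truth_neg, holds_tailVar]
    · rw [truth_labelBox]
    · simp [truth_literal, holds_copyVar]
  refine ⟨?_, has true, has false⟩
  by_cases h : w.val p
  · exact .inl (keeps true (by simpa using h))
  · exact .inr (keeps false (by simpa using h))

theorem truth_globally_updateAxioms (ps : List PropVar) (n : ℕ) :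
    frame.Truth w (globally (updateAxioms ps) n) :=
  frame.truth_globally_of_forall
    (fun w => frame.truth_updateAxioms.2 fun p _ => truth_updateAxiom w p) n w

/-- The worlds with empty label that realize the assignments of a team. -/
def teamOf {V : Set PropVar} (X : QPDL.Team V) : Set UpdateWorld.{u} :=
  {w | ∃ s ∈ X, w = ⟨s.Holds, [], false⟩}

theorem teamAgree_teamOf {V : Set PropVar} (X : QPDL.Team V) (U : Set PropVar) :
    QPDL.TeamAgree frame.{u} U X (teamOf X) := by
  have h : ∀ s : QPDL.Assignment V, QPDL.Agree frame.{u} U s ⟨s.Holds, [], false⟩ :=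
    fun s p _ => by
      rw [truthSet_frame]
      exact (holds_copyVar.{u} ⟨s.Holds, [], false⟩ p).symm
  refine ⟨fun s hs => ⟨_, ⟨s, hs, rfl⟩, h s⟩, ?_⟩
  rintro w ⟨s, hs, rfl⟩
  exact ⟨s, hs, h s⟩

end UpdateWorld

end MDL

/-! ### Correctness of the reductions -/

namespace QPDL

open MDL.Formula (updateAxioms globally globally_depFree updateAxioms_depFree)

/-- Any list containing the occurring variables and any sufficient depth will do; the machine can
thus use generous choices of `ps` and `n`. -/
theorem satisfiable_iff {φ : Formula} {ps : List PropVar} {n : ℕ} (hps : ∀ p ∈ φ.occ, p ∈ ps)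
    (hn : φ.depth ≤ n) :
    Satisfiable φ ↔ MDL.Satisfiable.{u} (.conj (globally (updateAxioms ps) n) φ.toMDL) := by
  constructor
  · rintro ⟨V, X, -, ⟨s, hs⟩, h⟩
    refine ⟨Set.univ, MDL.UpdateWorld.frame, MDL.UpdateWorld.teamOf X, Set.subset_univ _,
      ⟨_, s, hs, rfl⟩, ?_, ?_⟩
    · rw [MDL.KripkeModel.sat_iff_truth _ (globally_depFree (updateAxioms_depFree ps) n)]
      exact fun w _ => MDL.UpdateWorld.truth_globally_updateAxioms w ps n
    · exact (sat_toMDL hps hn (MDL.UpdateWorld.teamAgree_teamOf X _)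
        fun w _ => MDL.UpdateWorld.truth_globally_updateAxioms w ps n).2 h
  · rintro ⟨V, M, T, -, ⟨w, hw⟩, h₁, h₂⟩
    rw [MDL.KripkeModel.sat_iff_truth _ (globally_depFree (updateAxioms_depFree ps) n)] at h₁
    obtain ⟨s, hs, -⟩ := (teamAgree_teamOf T Set.univ).2 w hw
    exact ⟨Set.univ, teamOf T, Set.subset_univ _, ⟨s, hs⟩,
      (sat_toMDL hps hn (teamAgree_teamOf T _) h₁).1 h₂⟩

/-- The dual removes the worlds violating the axioms, so only the behaviour on update frames counts.
In the canonical frame nothing is removed. -/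
theorem valid_iff {φ : Formula} {ps : List PropVar} {n : ℕ} (hps : ∀ p ∈ φ.occ, p ∈ ps)
    (hn : φ.depth ≤ n) :
    Valid φ ↔ MDL.Valid.{u} (.disj (globally (updateAxioms ps) n).dual φ.toMDL) := by
  have hd := globally_depFree (updateAxioms_depFree ps) n
  constructor
  · intro h V M T _
    rw [MDL.KripkeModel.sat_disj_dual _ hd]
    exact (sat_toMDL hps hn (teamAgree_teamOf _ _) fun w hw => hw.2).2
      (h Set.univ _ (Set.subset_univ _))
  · intro h V X _
    have hX := h Set.univ MDL.UpdateWorld.frame (MDL.UpdateWorld.teamOf X) (Set.subset_univ _)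
    have hT := fun w => MDL.UpdateWorld.truth_globally_updateAxioms.{u} w ps n
    rw [MDL.KripkeModel.sat_disj_dual _ hd] at hX
    exact (sat_toMDL hps hn (MDL.UpdateWorld.teamAgree_teamOf X _) fun w _ => hT w).1
      (hX.mono _ fun w hw => ⟨hw, hT w⟩)

theorem entails_iff {S : List Formula} {φ : Formula} {ps : List PropVar} {n : ℕ}
    (hps : ∀ ψ ∈ φ :: S, ∀ p ∈ ψ.occ, p ∈ ps) (hn : ∀ ψ ∈ φ :: S, ψ.depth ≤ n) :
    Entails {ψ | ψ ∈ S} φ ↔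
      MDL.Entails.{u} {ψ | ψ ∈ globally (updateAxioms ps) n :: S.map Formula.toMDL} φ.toMDL := by
  have hd := globally_depFree (updateAxioms_depFree ps) n
  have hφ : φ ∈ φ :: S := List.mem_cons_self
  constructor
  · intro h V M T _ _ hS
    have hT := (M.sat_iff_truth hd T).1 (hS _ List.mem_cons_self)
    have key : ∀ ψ ∈ φ :: S, M.Sat T ψ.toMDL ↔ Sat Set.univ (teamOf T) ψ := fun ψ hψ =>
      sat_toMDL (hps ψ hψ) (hn ψ hψ) (teamAgree_teamOf T _) hT
    refine (key φ hφ).2 (h Set.univ _ (fun _ _ => Set.subset_univ _) (Set.subset_univ _)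
      fun ψ hψ => (key ψ (List.mem_cons_of_mem _ hψ)).1 (hS _ ?_))
    exact List.mem_cons_of_mem _ (List.mem_map_of_mem hψ)
  · intro h V X _ _ hS
    have hT := fun w => MDL.UpdateWorld.truth_globally_updateAxioms.{u} w ps n
    have key : ∀ ψ ∈ φ :: S,
        MDL.UpdateWorld.frame.Sat (MDL.UpdateWorld.teamOf X) ψ.toMDL ↔ Sat V X ψ :=
      fun ψ hψ => sat_toMDL (hps ψ hψ) (hn ψ hψ) (MDL.UpdateWorld.teamAgree_teamOf X _)
        fun w _ => hT w
    refine (key φ hφ).1 (h Set.univ MDL.UpdateWorld.frame _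
      (fun _ _ => Set.subset_univ _) (Set.subset_univ _) ?_)
    intro ψ hψ
    rcases List.mem_cons.1 hψ with rfl | hψ
    · exact (MDL.KripkeModel.sat_iff_truth _ hd _).2 fun w _ => hT w
    · obtain ⟨χ, hχ, rfl⟩ := List.mem_map.1 hψ
      exact (key χ (List.mem_cons_of_mem _ hχ)).2 (hS χ hχ)

end QPDL

/-! ### Structured programs for stack machines -/

/-- Programs operating on stacks over the alphabet `Γ`. The program `emit k w` pushes the symbols
of `w` one after another; `loop k isEnd body` pops symbols `a` from the stack `k` and runs `body a`,
until the stack is empty or a symbol with `isEnd a` has been popped. -/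
inductive StackProg (K Γ : Type) : Type
  | emit (k : K) (w : List Γ)
  | seq (p q : StackProg K Γ)
  | loop (k : K) (isEnd : Γ → Bool) (body : Γ → StackProg K Γ)

namespace StackProg

open Turing Function

variable {K Γ : Type}

/-- The control points of a program. -/
def Label : StackProg K Γ → Type
  | emit _ _ => Unit
  | seq p q => p.Label ⊕ q.Label
  | loop _ _ body => Option (Σ a, (body a).Label)

/-- The control point at which the program starts. -/
def entry : (p : StackProg K Γ) → p.Label
  | emit _ _ => ()
  | seq p _ => .inl p.entry
  | loop _ _ _ => none

theorem finite_label [Finite Γ] (p : StackProg K Γ) : Finite p.Label := by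
  induction p with
  | emit k w => exact inferInstanceAs (Finite Unit)
  | seq p q ih₁ ih₂ => exact inferInstanceAs (Finite (p.Label ⊕ q.Label))
  | loop k isEnd body ih => exact inferInstanceAs (Finite (Option (Σ a, (body a).Label)))

/-- The statement that pushes the symbols of a word one after another. -/
def pushAll {Λ σ : Type} (k : K) : List Γ → TM2.Stmt (fun _ : K => Γ) Λ σ →
    TM2.Stmt (fun _ : K => Γ) Λ σ
  | [], q => q
  | a :: w, q => .push k (fun _ => a) (pushAll k w q)

/-- The statements of a program whose control points are embedded into the labels `Λ`, and which
jumps to `exit` in the end. -/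
def code {Λ : Type} : (p : StackProg K Γ) → (p.Label → Λ) → Λ → p.Label →
    TM2.Stmt (fun _ : K => Γ) Λ (Option Γ)
  | emit k w, _, exit, _ => pushAll k w (.goto fun _ => exit)
  | seq p q, emb, _, .inl l => p.code (fun l => emb (.inl l)) (emb (.inr q.entry)) l
  | seq _ q, emb, exit, .inr l => q.code (fun l => emb (.inr l)) exit l
  | loop k isEnd body, emb, exit, none =>
    .pop k (fun _ a => a) (.goto fun v => match v with
      | none => exit
      | some a => if isEnd a then exit else emb (some ⟨a, (body a).entry⟩))
  | loop _ _ body, emb, _, some ⟨a, l⟩ => (body a).code (fun l => emb (some ⟨a, l⟩)) (emb none) l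

theorem code_loop_entry {Λ : Type} {k : K} {isEnd : Γ → Bool} {body : Γ → StackProg K Γ}
    (emb : (loop k isEnd body).Label → Λ) (exit : Λ) :
    (loop k isEnd body).code emb exit (loop k isEnd body).entry =
      .pop k (fun _ a => a) (.goto fun v => match v with
        | none => exit
        | some a => if isEnd a then exit else emb (some ⟨a, (body a).entry⟩)) :=
  rfl

/-! ### Execution of stack programs and composition of running times -/

variable [DecidableEq K]

/-- The machine `M` gets from `c` to `c'` in at most `t` steps. -/
def Within {Λ σ : Type} (M : Λ → TM2.Stmt (fun _ : K => Γ) Λ σ)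
    (c c' : TM2.Cfg (fun _ : K => Γ) Λ σ) (t : ℕ) : Prop :=
  ∃ n ≤ t, (flip bind (TM2.step M))^[n] (some c) = some c'

section Within

variable {Λ σ : Type} {M : Λ → TM2.Stmt (fun _ : K => Γ) Λ σ}
  {c₁ c₂ c₃ : TM2.Cfg (fun _ : K => Γ) Λ σ} {t t' : ℕ}

theorem Within.refl (c : TM2.Cfg (fun _ : K => Γ) Λ σ) : Within M c c 0 := ⟨0, le_rfl, rfl⟩

theorem Within.trans (h : Within M c₁ c₂ t) (h' : Within M c₂ c₃ t') :
    Within M c₁ c₃ (t + t') := by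
  obtain ⟨n, hn, h⟩ := h
  obtain ⟨n', hn', h'⟩ := h'
  refine ⟨n' + n, by omega, ?_⟩
  rw [iterate_add_apply, h, h']

theorem Within.mono (h : Within M c₁ c₂ t) (ht : t ≤ t') : Within M c₁ c₂ t' := by
  obtain ⟨n, hn, h⟩ := h
  exact ⟨n, hn.trans ht, h⟩

theorem Within.single {l : Λ} {v : σ} {S : K → List Γ} {c : TM2.Cfg (fun _ : K => Γ) Λ σ}
    (h : TM2.stepAux (M l) v S = c) : Within M ⟨some l, v, S⟩ c 1 :=
  ⟨1, le_rfl, congrArg some h⟩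

end Within

theorem stepAux_pushAll {Λ σ : Type} (k : K) (w : List Γ) (q : TM2.Stmt (fun _ : K => Γ) Λ σ)
    (v : σ) (S : K → List Γ) :
    TM2.stepAux (pushAll k w q) v S = TM2.stepAux q v (update S k (w.reverse ++ S k)) := by
  induction w generalizing S with
  | nil => simp [pushAll]
  | cons a w ih => simp [pushAll, ih]

/-- The program leads from the stacks `S` to the stacks `S'` in at most `t` steps. -/
def Runs (p : StackProg K Γ) (S S' : K → List Γ) (t : ℕ) : Prop :=
  ∀ ⦃Λ : Type⦄ (M : Λ → TM2.Stmt (fun _ : K => Γ) Λ (Option Γ)) (emb : p.Label → Λ) (exit : Λ),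
    (∀ l, M (emb l) = p.code emb exit l) →
      ∀ v, ∃ v', Within M ⟨some (emb p.entry), v, S⟩ ⟨some exit, v', S'⟩ t

/-- Some iterations of the loop lead from the stacks `S` to the stacks `S'` in at most `t` steps. -/
def Iter (k : K) (isEnd : Γ → Bool) (body : Γ → StackProg K Γ) (S S' : K → List Γ) (t : ℕ) :
    Prop :=
  ∀ ⦃Λ : Type⦄ (M : Λ → TM2.Stmt (fun _ : K => Γ) Λ (Option Γ))
    (emb : (loop k isEnd body).Label → Λ) (exit : Λ),
    (∀ l, M (emb l) = (loop k isEnd body).code emb exit l) →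
      ∀ v, ∃ v', Within M ⟨some (emb (loop k isEnd body).entry), v, S⟩
        ⟨some (emb (loop k isEnd body).entry), v', S'⟩ t

variable {p q : StackProg K Γ} {S S₁ S₂ S₃ S' : K → List Γ} {t t' : ℕ} {k : K} {isEnd : Γ → Bool}
  {body : Γ → StackProg K Γ} {a : Γ} {r : List Γ}

theorem Runs.mono (h : Runs p S S' t) (ht : t ≤ t') : Runs p S S' t' := fun _ M emb exit hM v =>
  let ⟨v', hv⟩ := h M emb exit hM v
  ⟨v', hv.mono ht⟩

theorem runs_emit (k : K) (w : List Γ) (S : K → List Γ) :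
    Runs (emit k w) S (update S k (w.reverse ++ S k)) 1 := fun _ M emb exit hM v => by
  refine ⟨v, Within.single ?_⟩
  rw [hM, code, stepAux_pushAll, TM2.stepAux]

theorem Runs.seq (h : Runs p S₁ S₂ t) (h' : Runs q S₂ S₃ t') :
    Runs (seq p q) S₁ S₃ (t + t') := fun _ M emb exit hM v => by
  obtain ⟨v₁, h₁⟩ := h M (fun l => emb (.inl l)) (emb (.inr q.entry)) (fun l => hM (.inl l)) v
  obtain ⟨v₂, h₂⟩ := h' M (fun l => emb (.inr l)) exit (fun l => hM (.inr l)) v₁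
  exact ⟨v₂, h₁.trans h₂⟩

theorem Iter.refl (S : K → List Γ) : Iter k isEnd body S S 0 := fun _ _ _ _ _ v =>
  ⟨v, Within.refl _⟩

theorem Iter.trans (h : Iter k isEnd body S₁ S₂ t) (h' : Iter k isEnd body S₂ S₃ t') :
    Iter k isEnd body S₁ S₃ (t + t') := fun _ M emb exit hM v => by
  obtain ⟨v₁, h₁⟩ := h M emb exit hM v
  obtain ⟨v₂, h₂⟩ := h' M emb exit hM v₁
  exact ⟨v₂, h₁.trans h₂⟩

theorem Iter.mono (h : Iter k isEnd body S S' t) (ht : t ≤ t') : Iter k isEnd body S S' t' :=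
  fun _ M emb exit hM v =>
    let ⟨v', hv⟩ := h M emb exit hM v
    ⟨v', hv.mono ht⟩

/-- One step pops `a` and branches to the copy of the body for `a`, whose exit is the head of the
loop. -/
theorem Runs.iter (h : Runs (body a) (update S k r) S' t) (hS : S k = a :: r)
    (ha : isEnd a = false) : Iter k isEnd body S S' (t + 1) := fun _ M emb exit hM v => by
  obtain ⟨v', h'⟩ := h M (fun l => emb (some ⟨a, l⟩)) (emb none) (fun l => hM (some ⟨a, l⟩))
    (some a)
  refine ⟨v', ((Within.single ?_).trans h').mono (by omega)⟩
  rw [hM, code_loop_entry]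
  simp [hS, ha]

theorem Iter.runs_nil (h : Iter k isEnd body S S' t) (hS : S' k = []) :
    Runs (loop k isEnd body) S S' (t + 1) := fun _ M emb exit hM v => by
  obtain ⟨v', h'⟩ := h M emb exit hM v
  refine ⟨none, h'.trans (Within.single ?_)⟩
  rw [hM, code_loop_entry]
  have hu : update S' k [] = S' := by rw [← hS, update_eq_self]
  simp [hS, hu]

theorem Iter.runs_end (h : Iter k isEnd body S S' t) (hS : S' k = a :: r) (ha : isEnd a = true) :
    Runs (loop k isEnd body) S (update S' k r) (t + 1) := fun _ M emb exit hM v => by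
  obtain ⟨v', h'⟩ := h M emb exit hM v
  refine ⟨some a, h'.trans (Within.single ?_)⟩
  rw [hM, code_loop_entry]
  simp [hS, ha]

/-! ### From stack programs to polynomial-time Turing machines -/

variable [Fintype K] [Fintype Γ]

/-- The machine that executes a program. -/
noncomputable def machine (p : StackProg K Γ) (k₀ k₁ : K) : FinTM2 where
  K := K
  k₀ := k₀
  k₁ := k₁
  Γ _ := Γ
  Λ := Option p.Label
  main := some p.entry
  ΛFin := @Fintype.ofFinite _ (@instFiniteOption _ p.finite_label)
  σ := Option Γ
  initialState := none
  Γk₀Fin := inferInstanceAs (Fintype Γ)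
  m l := match l with
    | none => .load (fun _ => none) .halt
    | some l => p.code some none l

/-- A function computed by a program in polynomially many steps is computable in polynomial
time. -/
theorem polyTime {α β : Type} {ea : α → List Γ} {eb : β → List Γ} {f : α → β}
    (p : StackProg K Γ) (k₀ k₁ : K) (time : Polynomial ℕ)
    (h : ∀ a, Runs p (update (fun _ => []) k₀ (ea a)) (update (fun _ => []) k₁ (eb (f a)))
      (time.eval (ea a).length)) :
    Nonempty (TM2ComputableInPolyTime ea eb f) := by
  have hstk : ∀ (k' : K) (s : List Γ) (k : K),
      (if _ : k = k' then s else []) = update (fun _ => []) k' s k := by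
    intro k' s k
    by_cases hk : k = k'
    · subst hk
      simp
    · simp [hk]
  -- The separate `s` and `s'` absorb the identity maps by which the definition of computability
  -- translates between alphabets.
  have key : ∀ a s s', s = ea a → s' = eb (f a) → ∃ n ≤ (time + 1).eval (ea a).length,
      (flip bind (p.machine k₀ k₁).step)^[n] (some (initList (p.machine k₀ k₁) s)) =
        some (haltList (p.machine k₀ k₁) s') := by
    rintro a s s' rfl rfl
    obtain ⟨v, hv⟩ := h a (p.machine k₀ k₁).m some none (fun _ => rfl) none
    have h₀ : initList (p.machine k₀ k₁) (ea a) =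
        (⟨some (some p.entry), none, update (fun _ => []) k₀ (ea a)⟩ :
          TM2.Cfg (fun _ : K => Γ) (Option p.Label) (Option Γ)) :=
      congrArg (TM2.Cfg.mk _ _) (funext fun k => hstk k₀ (ea a) k)
    have h₁ : haltList (p.machine k₀ k₁) (eb (f a)) =
        (⟨none, none, update (fun _ => []) k₁ (eb (f a))⟩ :
          TM2.Cfg (fun _ : K => Γ) (Option p.Label) (Option Γ)) :=
      congrArg (TM2.Cfg.mk _ _) (funext fun k => hstk k₁ (eb (f a)) k)
    -- The extra step in `time + 1` resets the register to its initial state and halts.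
    obtain ⟨n, hn, h'⟩ := hv.trans (Within.single rfl)
    rw [h₀, h₁]
    exact ⟨n, by simpa using hn, h'⟩
  choose n hn h' using fun a => key a _ _ (List.map_id (ea a)) (List.map_id (eb (f a)))
  exact ⟨{
    tm := p.machine k₀ k₁
    inputAlphabet := Equiv.refl _
    outputAlphabet := Equiv.refl _
    time := time + 1
    outputsFun := fun a =>
      { steps := n a
        evals_in_steps := h' a
        steps_le_m := hn a } }⟩

end StackProg

/-! ### Words with a parameter -/

namespace Token

/-- The symbol that takes the place of a symbol in the dual formula. -/
def dual : Token → Token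
  | pos => neg
  | neg => pos
  | conj => disj
  | disj => conj
  | box => dia
  | dia => box
  | t => t

end Token

/-- A word depending on a variable name: a factor for each bit of the name, a middle part, and a
closing factor for each bit. -/
structure Template : Type where
  pre : Bool → List Token
  mid : List Token
  post : List Token

namespace Template

/-- The word for the name `p`. -/
def expand (τ : Template) (p : PropVar) : List Token :=
  p.flatMap τ.pre ++ (τ.mid ++ (List.replicate p.length τ.post).flatten)

/-- Apply a map to all symbols. -/
def map (τ : Template) (δ : Token → Token) : Template where
  pre b := (τ.pre b).map δ
  mid := τ.mid.map δ
  post := τ.post.map δ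

/-- The concatenation of the words of several templates. -/
def expandAll (ts : List Template) (p : PropVar) : List Token := ts.flatMap (·.expand p)

theorem expandAll_map (ts : List Template) (δ : Token → Token) (p : PropVar) :
    expandAll (ts.map (·.map δ)) p = (expandAll ts p).map δ := by
  simp [expandAll, expand, map, List.flatMap_map, List.map_flatMap, List.map_flatten]

/-- A bound for the length of the words of a template, relative to the length of the name. -/
def size (τ : Template) : ℕ :=
  (τ.pre true).length + (τ.pre false).length + τ.mid.length + τ.post.length

/-- A bound for the length of the words of a list of templates, and for the time to write them,
relative to the length of the name. -/
def cost (ts : List Template) : ℕ := (ts.map size).sum + 6 * (ts.length + 1)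

theorem length_expand_le (τ : Template) (p : PropVar) :
    (τ.expand p).length ≤ τ.size * (p.length + 1) := by
  have h : (p.flatMap τ.pre).length ≤
      ((τ.pre true).length + (τ.pre false).length) * p.length := by
    induction p with
    | nil => simp
    | cons b p ih =>
      rw [List.flatMap_cons, List.length_append, List.length_cons, mul_add_one]
      cases b <;> omega
  have h' : (List.replicate p.length τ.post).flatten.length = τ.post.length * p.length := by
    simp [mul_comm]
  simp only [expand, List.length_append, h', size, add_mul, mul_add, mul_one] at h ⊢
  omega

theorem length_expandAll_le (ts : List Template) (p : PropVar) :
    (expandAll ts p).length ≤ cost ts * (p.length + 1) := by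
  have h : (expandAll ts p).length ≤ (ts.map size).sum * (p.length + 1) := by
    induction ts with
    | nil => simp [expandAll]
    | cons τ ts ih =>
      have := τ.length_expand_le p
      simp only [expandAll, List.flatMap_cons, List.length_append, List.map_cons, List.sum_cons,
        add_mul] at ih ⊢
      omega
  exact h.trans (Nat.mul_le_mul_right _ (Nat.le_add_right _ _))

/-- The template of a constant word. -/
def word (w : List Token) : Template := ⟨fun _ => [], w, []⟩

/-- The name of the copy of the variable. -/
def copyName : Template := ⟨fun b => [.bit b], [.bit true, .sep], []⟩

open MDL.Formula

/-- The formulae saying that the label is `p`. -/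
def labelBox : Template where
  pre b := .conj :: ((pos moreVar).write ++ .conj :: ((literal b bitVar).write ++
    .box :: .disj :: (neg tailVar).write))
  mid := (neg moreVar).write
  post := List.replicate 4 .close

/-- The formulae saying that the label can be read as `p`. -/
def labelDia : Template where
  pre b := .conj :: ((pos moreVar).write ++ .conj :: ((literal b bitVar).write ++
    .dia :: .conj :: (pos tailVar).write))
  mid := (neg moreVar).write
  post := List.replicate 4 .close

/-- The literals of the copy of `p`. -/
def literalCopy (b : Bool) : List Template := [word [cond b .pos .neg], copyName]

/-- The formulae `isUpdate p`. -/
def isUpdate : List Template :=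
  [word (.conj :: (neg tailVar).write), labelBox, word [.close]]

/-- The formulae `keepsValue b p`. -/
def keepsValue (b : Bool) : List Template :=
  word [.conj] :: (literalCopy b ++ word [.box, .disj] :: (literalCopy b ++
    [word (.disj :: (pos tailVar).write), labelDia, word (List.replicate 4 .close)]))

/-- The formulae `hasUpdate b p`. -/
def hasUpdate (b : Bool) : List Template :=
  word [.dia, .conj] :: (isUpdate ++ (literalCopy b ++ [word [.close, .close]]))

/-- The formulae `updateAxiom p`. -/
def updateAxiom : List Template :=
  word [.conj, .disj] :: (keepsValue true ++ (keepsValue false ++ word [.close, .conj] ::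
    (hasUpdate true ++ (hasUpdate false ++ [word [.close, .close]]))))

theorem expandAll_nil (p : PropVar) : expandAll [] p = [] := rfl

theorem expandAll_cons (τ : Template) (ts : List Template) (p : PropVar) :
    expandAll (τ :: ts) p = τ.expand p ++ expandAll ts p :=
  List.flatMap_cons

theorem expandAll_append (ts ts' : List Template) (p : PropVar) :
    expandAll (ts ++ ts') p = expandAll ts p ++ expandAll ts' p :=
  List.flatMap_append

/-- This recursion on the name has the shape of those for `labelBox` and `labelDia`: each bit opens
four brackets at the front that `post` closes at the back. -/
theorem expand_cons (τ : Template) (b : Bool) (p : PropVar) :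
    τ.expand (b :: p) = τ.pre b ++ (τ.expand p ++ τ.post) := by
  simp [expand, List.replicate_succ', List.flatten_append]

theorem expand_word (w : List Token) (p : PropVar) : (word w).expand p = w := by
  simp [word, expand]

theorem expand_copyName (p : PropVar) : copyName.expand p = writeVar (copyVar p) := by
  induction p with
  | nil => rfl
  | cons b p ih =>
    rw [expand_cons, ih]
    simp [copyName, writeVar, copyVar]

theorem expand_labelBox (p : PropVar) :
    labelBox.expand p = (MDL.Formula.labelBox p).write := by
  induction p with
  | nil => rfl
  | cons b p ih =>
    rw [expand_cons, ih]
    simp [labelBox, MDL.Formula.labelBox, write, List.replicate]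

theorem expand_labelDia (p : PropVar) :
    labelDia.expand p = (MDL.Formula.labelDia p).write := by
  induction p with
  | nil => rfl
  | cons b p ih =>
    rw [expand_cons, ih]
    simp [labelDia, MDL.Formula.labelDia, write, List.replicate]

theorem expandAll_literalCopy (b : Bool) (p : PropVar) :
    expandAll (literalCopy b) p = (literal b (copyVar p)).write := by
  cases b <;>
    simp [literalCopy, expandAll_cons, expandAll_nil, expand_word, expand_copyName, literal, write]

theorem expandAll_isUpdate (p : PropVar) :
    expandAll isUpdate p = (MDL.Formula.isUpdate p).write := by
  simp [isUpdate, MDL.Formula.isUpdate, expandAll_cons, expandAll_nil, expand_word,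
    expand_labelBox, write]

theorem expandAll_keepsValue (b : Bool) (p : PropVar) :
    expandAll (keepsValue b) p = (MDL.Formula.keepsValue b p).write := by
  simp [keepsValue, MDL.Formula.keepsValue, expandAll_cons, expandAll_nil, expandAll_append,
    expand_word, expand_labelDia, expandAll_literalCopy, write, List.replicate]

theorem expandAll_hasUpdate (b : Bool) (p : PropVar) :
    expandAll (hasUpdate b) p = (MDL.Formula.hasUpdate b p).write := by
  simp [hasUpdate, MDL.Formula.hasUpdate, expandAll_cons, expandAll_nil, expandAll_append,
    expand_word, expandAll_isUpdate, expandAll_literalCopy, write]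

theorem expandAll_updateAxiom (p : PropVar) :
    expandAll updateAxiom p = (MDL.Formula.updateAxiom p).write := by
  simp [updateAxiom, MDL.Formula.updateAxiom, expandAll_cons, expandAll_nil, expandAll_append,
    expand_word, expandAll_keepsValue, expandAll_hasUpdate, write]

end Template

/-! ### The written form of duals and axioms -/

namespace MDL.Formula

/-- Dualization leaves the tree, its brackets and its names in place and only exchanges symbols, so
it can be performed while writing. -/
theorem write_dual (φ : Formula) : φ.dual.write = φ.write.map Token.dual := by
  have hv : ∀ p, (writeVar p).map Token.dual = writeVar p := fun p => by
    simp [writeVar, Token.dual, Function.comp_def]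
  induction φ <;>
    simp_all [dual, write, Token.dual, List.map_flatMap]

theorem write_updateAxioms (ps : List PropVar) :
    (updateAxioms ps).write = ps.flatMap (fun p => .conj :: (updateAxiom p).write) ++
      (top.write ++ List.replicate ps.length .close) := by
  induction ps with
  | nil => simp [updateAxioms]
  | cons p ps ih => simp [updateAxioms, write, ih, List.replicate_succ']

/-- The nested formula is a repeated block, a core and a repeated pair of brackets, hence writable
by a loop and a counter. -/
theorem write_globally (φ : Formula) (n : ℕ) :
    (globally φ n).write = (List.replicate n (.conj :: (φ.write ++ [.box]))).flatten ++
      (top.write ++ (List.replicate n [.close, .close]).flatten) := by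
  induction n with
  | zero => simp [globally]
  | succ n ih =>
    rw [globally, write, write, ih, List.replicate_succ,
      List.replicate_succ' (a := [Token.close, Token.close])]
    simp

end MDL.Formula

/-! ### The program -/

namespace StackProg

section

variable {K Γ : Type} [DecidableEq K]

/-- Pop all symbols of `k` and push them on `k'`. -/
def move (k k' : K) : StackProg K Γ := loop k (fun _ => false) fun a => emit k' [a]

open Function in
theorem runs_move {k k' : K} (hk : k ≠ k') (S : K → List Γ) :
    Runs (move k k') S (update (update S k []) k' ((S k).reverse ++ S k'))
      (2 * (S k).length + 1) := by
  suffices h : Iter k (fun _ => false) (fun a => emit k' [a]) S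
      (update (update S k []) k' ((S k).reverse ++ S k')) (2 * (S k).length) from
    h.runs_nil (by simp [hk])
  generalize hs : S k = s
  induction s generalizing S with
  | nil =>
    have : update (update S k []) k' (S k') = S := by
      rw [← hs, update_eq_self, update_eq_self]
    simpa [this] using Iter.refl S
  | cons a s ih =>
    have h₁ := (runs_emit k' [a] (update S k s)).iter (isEnd := fun _ => false)
      (body := fun a => emit k' [a]) hs rfl
    have h₂ := ih (update (update S k s) k' ([a].reverse ++ update S k s k')) (by simp [hk])
    have := (h₁.trans h₂).mono (t' := 2 * (a :: s).length) (by simp; omega)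
    convert this using 1
    rw [update_comm hk.symm, update_idem, update_idem]
    simp [hk.symm]

end

/-- The stacks of the translation program. -/
inductive Stk : Type
  | inp
  | copy
  | clock
  | bits
  | name
  | brackets
  | depth
  | acc
  | out
  deriving DecidableEq

instance : Fintype Stk where
  elems := {.inp, .copy, .clock, .bits, .name, .brackets, .depth, .acc, .out}
  complete k := by cases k <;> decide

/-- The contents of the stacks. -/
structure Mem : Type where
  inp : List Token := []
  copy : List Token := []
  clock : List Token := []
  bits : List Token := []
  name : List Token := []
  brackets : List Token := []
  depth : List Token := []
  acc : List Token := []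
  out : List Token := []

namespace Mem

/-- The contents of a stack. -/
def fn (m : Mem) : Stk → List Token
  | .inp => m.inp
  | .copy => m.copy
  | .clock => m.clock
  | .bits => m.bits
  | .name => m.name
  | .brackets => m.brackets
  | .depth => m.depth
  | .acc => m.acc
  | .out => m.out

/-- Change the contents of a stack. -/
def set (m : Mem) (k : Stk) (s : List Token) : Mem :=
  match k with
  | .inp => { m with inp := s }
  | .copy => { m with copy := s }
  | .clock => { m with clock := s }
  | .bits => { m with bits := s }
  | .name => { m with name := s }
  | .brackets => { m with brackets := s }
  | .depth => { m with depth := s }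
  | .acc => { m with acc := s }
  | .out => { m with out := s }

/-- Append a word to the output, which is kept in reverse. -/
def put (m : Mem) (w : List Token) : Mem := { m with acc := w.reverse ++ m.acc }

theorem fn_set (m : Mem) (k : Stk) (s : List Token) :
    (m.set k s).fn = Function.update m.fn k s := by
  funext k'
  cases k <;> cases k' <;> rfl

theorem put_put (m : Mem) (w w' : List Token) : (m.put w).put w' = m.put (w ++ w') := by
  simp [put]

theorem put_nil (m : Mem) : m.put [] = m := rfl

end Mem

theorem runs_emit_set (k : Stk) (w : List Token) (m : Mem) :
    Runs (emit k w) m.fn (m.set k (w.reverse ++ m.fn k)).fn 1 := by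
  rw [Mem.fn_set]
  exact runs_emit k w m.fn

theorem runs_put (w : List Token) (m : Mem) : Runs (emit .acc w) m.fn (m.put w).fn 1 :=
  runs_emit_set .acc w m

theorem runs_move_set {k k' : Stk} (hk : k ≠ k') (m : Mem) :
    Runs (move k k') m.fn ((m.set k []).set k' ((m.fn k).reverse ++ m.fn k')).fn
      (2 * (m.fn k).length + 1) := by
  rw [Mem.fn_set, Mem.fn_set]
  exact runs_move hk m.fn

theorem Runs.iter_set {k : Stk} {isEnd : Token → Bool} {body : Token → StackProg Stk Token}
    {a : Token} {r : List Token} {m : Mem} {S : Stk → List Token} {t : ℕ}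
    (h : Runs (body a) (m.set k r).fn S t) (hm : m.fn k = a :: r) (ha : isEnd a = false) :
    Iter k isEnd body m.fn S (t + 1) := by
  rw [Mem.fn_set] at h
  exact h.iter hm ha

theorem Runs.conv {p : StackProg Stk Token} {S : Stk → List Token} {m m' : Mem} {t t' : ℕ}
    (h : Runs p S m.fn t) (hm : m = m') (ht : t ≤ t') : Runs p S m'.fn t' :=
  hm ▸ h.mono ht

theorem Iter.conv {k : Stk} {isEnd : Token → Bool} {body : Token → StackProg Stk Token}
    {S : Stk → List Token} {m m' : Mem} {t t' : ℕ}
    (h : Iter k isEnd body S m.fn t) (hm : m = m') (ht : t ≤ t') : Iter k isEnd body S m'.fn t' :=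
  hm ▸ h.mono ht

/-- For each symbol of `k`, write the word `w`. -/
def drain (k : Stk) (w : List Token) : StackProg Stk Token :=
  loop k (fun _ => false) fun _ => emit .acc w

theorem runs_drain {k : Stk} (hk : k ≠ .acc) (w : List Token) (m : Mem) :
    Runs (drain k w) m.fn ((m.set k []).put (List.replicate (m.fn k).length w).flatten).fn
      (2 * (m.fn k).length + 1) := by
  suffices h : Iter k (fun _ => false) (fun _ => emit .acc w) m.fn
      ((m.set k []).put (List.replicate (m.fn k).length w).flatten).fn (2 * (m.fn k).length) from
    h.runs_nil (by cases k <;> first | rfl | exact absurd rfl hk)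
  generalize hs : m.fn k = s
  induction s generalizing m with
  | nil =>
    have : m.set k [] = m := by rw [← hs]; cases k <;> rfl
    simpa [this, Mem.put_nil] using Iter.refl m.fn
  | cons a s ih =>
    have h₁ := (runs_put w (m.set k s)).iter_set (isEnd := fun _ => false)
      (body := fun _ => emit .acc w) hs rfl
    have h₂ := ih ((m.set k s).put w) (by cases k <;> first | rfl | exact absurd rfl hk)
    have h₃ := (h₁.trans h₂).mono (t' := 2 * (a :: s).length) (by simp; omega)
    have h₄ : (((m.set k s).put w).set k []) = (m.set k []).put w := by
      cases k <;> first | rfl | exact absurd rfl hk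
    rwa [h₄, Mem.put_put, ← List.flatten_cons, ← List.replicate_succ] at h₃

/-- Write the word of a template for the name on the stack `name`. -/
def writeTemplate (τ : Template) : StackProg Stk Token :=
  seq (loop .name (fun _ => false) fun a => match a with
      | .bit b => seq (emit .acc (τ.pre b)) (emit .bits [.bit b])
      | _ => emit .acc [])
    (seq (emit .acc τ.mid)
      (loop .bits (fun _ => false) fun a => seq (emit .acc τ.post) (emit .name [a])))

theorem runs_writeTemplate (τ : Template) (p : PropVar) (m : Mem) (hb : m.bits = [])
    (hn : m.name = p.map .bit) :
    Runs (writeTemplate τ) m.fn (m.put (τ.expand p)).fn (6 * p.length + 3) := by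
  have h₁ : ∀ (m : Mem) (p : PropVar), m.name = p.map .bit →
      Iter .name (fun _ => false) (fun a => match a with
        | .bit b => seq (emit .acc (τ.pre b)) (emit .bits [.bit b])
        | _ => emit .acc []) m.fn
        (((m.set .name []).set .bits ((p.map .bit).reverse ++ m.bits)).put (p.flatMap τ.pre)).fn
        (3 * p.length) := by
    intro m p hn
    induction p generalizing m with
    | nil =>
      obtain ⟨_, _, _, _, _, _, _, _, _⟩ := m
      cases hn
      exact Iter.refl _
    | cons b p ih =>
      refine ((((runs_put (τ.pre b) _).seq (runs_emit_set .bits [.bit b] _)).iter_set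
        (m := m) (k := .name) (a := .bit b) (r := p.map .bit) hn rfl).trans (ih _ rfl)).conv ?_ ?_
      · simp [Mem.put, Mem.set, Mem.fn]
      · simp only [List.length_cons]
        omega
  -- The second pass reverses the name again and so restores it for the next template.
  have h₂ : ∀ (m : Mem) (s : List Token), m.bits = s →
      Iter .bits (fun _ => false) (fun a => seq (emit .acc τ.post) (emit .name [a])) m.fn
        (((m.set .bits []).set .name (s.reverse ++ m.name)).put
          (List.replicate s.length τ.post).flatten).fn (3 * s.length) := by
    intro m s hb
    induction s generalizing m with
    | nil =>
      obtain ⟨_, _, _, _, _, _, _, _, _⟩ := m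
      cases hb
      exact Iter.refl _
    | cons a s ih =>
      refine ((((runs_put τ.post _).seq (runs_emit_set .name [a] _)).iter_set
        (m := m) (k := .bits) (a := a) (r := s) hb rfl).trans (ih _ rfl)).conv ?_ ?_
      · simp [Mem.put, Mem.set, Mem.fn, List.replicate_succ]
      · simp only [List.length_cons]
        omega
  obtain ⟨_, _, _, _, _, _, _, _, _⟩ := m
  cases hb
  cases hn
  refine (((h₁ _ p rfl).runs_nil rfl).seq
    ((runs_put τ.mid _).seq ((h₂ _ (p.map .bit).reverse ?_).runs_nil rfl))).conv ?_ ?_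
  · simp [Mem.put, Mem.set]
  · simp [Mem.put, Mem.set, Template.expand]
  · simp only [List.length_reverse, List.length_map]
    omega

/-- Write the words of several templates for the name on the stack `name`. -/
def writeTemplates : List Template → StackProg Stk Token
  | [] => emit .acc []
  | τ :: ts => seq (writeTemplate τ) (writeTemplates ts)

theorem runs_writeTemplates (ts : List Template) (p : PropVar) (m : Mem) (hb : m.bits = [])
    (hn : m.name = p.map .bit) :
    Runs (writeTemplates ts) m.fn (m.put (Template.expandAll ts p)).fn
      (ts.length * (6 * p.length + 3) + 1) := by
  induction ts generalizing m with
  | nil => exact (runs_put [] m).mono (by simp)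
  | cons τ ts ih =>
    refine ((runs_writeTemplate τ p m hb hn).seq (ih _ hb hn)).conv ?_ ?_
    · rw [Mem.put_put, Template.expandAll_cons]
    · rw [List.length_cons, add_mul]
      omega

/-- Write the words of several templates for the name that is kept in reverse on the stack
`bits`, and clear this stack. -/
def writeFor (ts : List Template) : StackProg Stk Token :=
  seq (move .bits .name) (seq (writeTemplates ts) (drain .name []))

theorem runs_writeFor (ts : List Template) (p : PropVar) (m : Mem)
    (hb : m.bits = (p.map .bit).reverse) (hn : m.name = []) :
    Runs (writeFor ts) m.fn ((m.set .bits []).put (Template.expandAll ts p)).fn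
      (Template.cost ts * (p.length + 1)) := by
  obtain ⟨_, _, _, _, _, _, _, _, _⟩ := m
  subst hb hn
  refine ((runs_move_set (k := .bits) (k' := .name) (by decide) _).seq
    ((runs_writeTemplates ts p _ rfl ?_).seq (runs_drain (k := .name) (by decide) [] _))).conv ?_ ?_
  · simp [Mem.set, Mem.fn]
  · simp [Mem.set, Mem.fn, Mem.put]
  · simp only [Mem.fn, Mem.set, Mem.put, List.length_append, List.length_reverse, List.length_map,
      List.length_nil, Template.cost, add_mul, mul_add, mul_one]
    have : ts.length * (6 * p.length) = 6 * ts.length * p.length := by ring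
    omega

end StackProg

/-! ### Scanning for names, writing the axioms and translating formulae -/

namespace StackProg

open MDL.Formula (top updateAxioms globally copyVar)

/-- The variable names in a string, when `acc` has been read of the first name. -/
def names : List Bool → List Token → List PropVar
  | _, [] => []
  | acc, .bit b :: s => names (b :: acc) s
  | acc, .sep :: s => acc.reverse :: names [] s
  | acc, _ :: s => names acc s

theorem length_names_le (acc : List Bool) (s : List Token) : (names acc s).length ≤ s.length := by
  induction s generalizing acc with
  | nil => simp [names]
  | cons a s ih =>
    have h₁ := ih acc
    have h₂ := ih []
    cases a with
    | bit b => exact (ih (b :: acc)).trans (by simp)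
    | _ => simp only [names, List.length_cons]; omega

theorem length_flatMap_names_le (ts : List Template) (acc : List Bool) (s : List Token) :
    ((names acc s).flatMap (Template.expandAll ts)).length ≤
      Template.cost ts * (2 * s.length + acc.length) := by
  induction s generalizing acc with
  | nil => simp [names]
  | cons a s ih =>
    cases a with
    | bit b =>
      refine (ih (b :: acc)).trans (Nat.mul_le_mul_left _ ?_)
      simp only [List.length_cons]
      omega
    | sep =>
      have h₁ := ih []
      have h₂ := Template.length_expandAll_le ts acc.reverse
      simp only [names, List.flatMap_cons, List.length_append, List.length_cons, mul_add,
        List.length_reverse, List.length_nil] at h₁ h₂ ⊢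
      omega
    | _ =>
      refine (ih acc).trans (Nat.mul_le_mul_left _ ?_)
      simp only [List.length_cons]
      omega

/-- Process a symbol of the input: names are collected on the stack `bits`, and completed names
are passed to the templates. -/
def scan (ts : List Template) : Token → StackProg Stk Token
  | .bit b => seq (emit .bits [.bit b]) (emit .copy [.bit b])
  | .sep => seq (emit .copy [.sep]) (seq (emit .brackets [.sep]) (writeFor ts))
  | t => emit .copy [t]

theorem six_le_cost (ts : List Template) : 6 ≤ Template.cost ts := by
  unfold Template.cost
  omega

/-- The time bound is amortized: a bit is counted once when it is read and once more, through `acc`,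
when its name is completed. The stack `bits` retains whatever follows the last separator, hence the
existential. -/
theorem iter_scan (ts : List Template) (s : List Token) (acc : List Bool) (m : Mem)
    (hi : m.inp = s) (hb : m.bits = acc.map .bit) (hn : m.name = []) :
    ∃ bits : List Token, bits.length ≤ acc.length + s.length ∧
      Iter .inp (fun _ => false) (scan ts) m.fn
        ((((m.put ((names acc s).flatMap (Template.expandAll ts))).set .inp []).set .copy
          (s.reverse ++ m.copy)).set .bits bits |>.set .brackets
            (List.replicate (names acc s).length .sep ++ m.brackets)).fn
        (Template.cost ts * (2 * s.length + acc.length)) := by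
  have hc := six_le_cost ts
  induction s generalizing acc m with
  | nil =>
    obtain ⟨_, _, _, _, _, _, _, _, _⟩ := m
    dsimp only at hi hb hn
    subst hi hb hn
    exact ⟨acc.map .bit, by simp, (Iter.refl _).mono (by simp)⟩
  | cons a s ih =>
    have other : scan ts a = emit .copy [a] → names acc (a :: s) = names acc s →
        ∃ bits : List Token, bits.length ≤ acc.length + (a :: s).length ∧
        Iter .inp (fun _ => false) (scan ts) m.fn
          ((((m.put ((names acc (a :: s)).flatMap (Template.expandAll ts))).set .inp []).set .copy
            ((a :: s).reverse ++ m.copy)).set .bits bits |>.set .brackets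
              (List.replicate (names acc (a :: s)).length .sep ++ m.brackets)).fn
          (Template.cost ts * (2 * (a :: s).length + acc.length)) := by
      intro ha hnames
      obtain ⟨bits, hbits, h⟩ := ih acc ((m.set .inp s).set .copy ([a].reverse ++ m.copy)) rfl hb hn
      refine ⟨bits, hbits.trans (by simp), (Iter.trans (Runs.iter_set (k := .inp)
        (m := m) (a := a) (r := s) (t := 1) ?_ hi rfl) h).conv ?_ ?_⟩
      · rw [ha]
        exact runs_emit_set .copy [a] _
      · rw [hnames]
        simp [Mem.put, Mem.set]
      · simp only [List.length_cons, mul_add]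
        omega
    cases a with
    | bit b =>
      obtain ⟨bits, hbits, h⟩ := ih (b :: acc)
        (((m.set .inp s).set .bits ([.bit b].reverse ++ m.bits)).set .copy
          ([.bit b].reverse ++ m.copy)) rfl (by simp [Mem.set, hb]) hn
      refine ⟨bits, hbits.trans (by simp only [List.length_cons]; omega),
        (Iter.trans (Runs.iter_set (k := .inp) (m := m) (a := .bit b) (r := s)
          ((runs_emit_set .bits [.bit b] _).seq
          (runs_emit_set .copy [.bit b] _)) hi rfl) h).conv ?_ ?_⟩
      · simp [Mem.put, Mem.set, names]
      · simp only [List.length_cons, mul_add]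
        omega
    | sep =>
      obtain ⟨bits, hbits, h⟩ := ih []
        (((((m.set .inp s).set .copy ([.sep].reverse ++ m.copy)).set .brackets
          ([.sep].reverse ++ m.brackets)).set .bits []).put (Template.expandAll ts acc.reverse))
        rfl rfl hn
      refine ⟨bits, hbits.trans (by simp only [List.length_cons, List.length_nil]; omega),
        (Iter.trans (Runs.iter_set (k := .inp) (m := m) (a := .sep) (r := s)
          ((runs_emit_set .copy [.sep] _).seq
          ((runs_emit_set .brackets [.sep] _).seq (runs_writeFor ts acc.reverse _ ?_ (by exact hn))))
          hi rfl) h).conv ?_ ?_⟩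
      · simpa [Mem.set] using hb
      · simp [Mem.put, Mem.set, names, List.replicate_succ']
      · simp only [List.length_cons, mul_add, List.length_reverse, List.length_nil]
        omega
    | _ => exact other rfl rfl

/-- The templates of the update axioms and of the symbol by which the axioms are joined. -/
def axiomTemplates (δ : Token → Token) : List Template :=
  (Template.word [.conj] :: Template.updateAxiom).map (·.map δ)

theorem expandAll_axiomTemplates (δ : Token → Token) (p : PropVar) :
    Template.expandAll (axiomTemplates δ) p =
      (.conj :: (MDL.Formula.updateAxiom p).write).map δ := by
  rw [axiomTemplates, Template.expandAll_map, Template.expandAll_cons, Template.expand_word,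
    Template.expandAll_updateAxiom]
  rfl

/-- Write the update axioms of the variables in the input. -/
def writeAxioms (δ : Token → Token) : StackProg Stk Token :=
  seq (loop .inp (fun _ => false) (scan (axiomTemplates δ)))
    (seq (drain .bits []) (seq (emit .acc (top.write.map δ))
      (seq (drain .brackets [δ .close]) (move .copy .inp))))

/-- The input is saved on `copy` during the scan and moved back, so that the program can be repeated
at every level of nesting. The stack `brackets` counts the conjunctions to be closed. -/
theorem runs_writeAxioms (δ : Token → Token) (m : Mem) (hb : m.bits = []) (hn : m.name = [])
    (hc : m.copy = []) (hr : m.brackets = []) :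
    Runs (writeAxioms δ) m.fn (m.put ((updateAxioms (names [] m.inp)).write.map δ)).fn
      ((2 * Template.cost (axiomTemplates δ) + 6) * m.inp.length + 5) := by
  obtain ⟨bits, hbits, h⟩ := iter_scan (axiomTemplates δ) m.inp [] m rfl hb hn
  have hl := length_names_le [] m.inp
  refine ((h.runs_nil rfl).seq ((runs_drain (k := .bits) (by decide) [] _).seq
    ((runs_put _ _).seq ((runs_drain (k := .brackets) (by decide) [δ .close] _).seq
      (runs_move_set (k := .copy) (k' := .inp) (by decide) _))))).conv ?_ ?_
  · obtain ⟨inp, copy, clock, bits', name, brackets, depth, acc, out⟩ := m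
    dsimp only at hb hn hc hr
    subst hb hn hc hr
    simp [Mem.put, Mem.set, Mem.fn, MDL.Formula.write_updateAxioms, List.map_flatMap,
      funext (expandAll_axiomTemplates δ)]
  · simp only [Mem.set, Mem.fn, Mem.put, hc, hr, List.append_nil, List.length_replicate,
      List.length_reverse, List.length_nil, add_mul] at hbits ⊢
    have : Template.cost (axiomTemplates δ) * (2 * m.inp.length + 0) =
      2 * Template.cost (axiomTemplates δ) * m.inp.length := by ring
    omega

/-- Write the update axioms, relativized to the worlds reachable in a number of steps that is
given by the stack `clock`. -/
def writeGlobally (δ : Token → Token) : StackProg Stk Token :=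
  seq (loop .clock (fun _ => false) fun _ => seq (emit .acc [δ .conj]) (seq (writeAxioms δ)
      (seq (emit .acc [δ .box]) (emit .depth [.sep]))))
    (seq (emit .acc (top.write.map δ)) (drain .depth [δ .close, δ .close]))

theorem runs_writeGlobally (δ : Token → Token) (m : Mem) (hb : m.bits = []) (hn : m.name = [])
    (hc : m.copy = []) (hr : m.brackets = []) (hd : m.depth = []) :
    Runs (writeGlobally δ) m.fn ((m.set .clock []).put
      ((globally (updateAxioms (names [] m.inp)) m.clock.length).write.map δ)).fn
      (((2 * Template.cost (axiomTemplates δ) + 6) * m.inp.length + 11) * m.clock.length + 3) := by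
  have iter : ∀ (c : List Token) (m : Mem), m.clock = c → m.bits = [] → m.name = [] →
      m.copy = [] → m.brackets = [] →
      Iter .clock (fun _ => false) (fun _ => seq (emit .acc [δ .conj]) (seq (writeAxioms δ)
        (seq (emit .acc [δ .box]) (emit .depth [.sep])))) m.fn
        (((m.set .clock []).set .depth (List.replicate c.length .sep ++ m.depth)).put
          ((List.replicate c.length (.conj :: ((updateAxioms (names [] m.inp)).write ++
            [.box]))).flatten.map δ)).fn
        (((2 * Template.cost (axiomTemplates δ) + 6) * m.inp.length + 9) * c.length) := by
    intro c
    induction c with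
    | nil =>
      intro m hm _ _ _ _
      obtain ⟨_, _, _, _, _, _, _, _, _⟩ := m
      dsimp only at hm
      subst hm
      exact Iter.refl _
    | cons a c ih =>
      intro m hm hb hn hc hr
      have hax := runs_writeAxioms δ ((m.set .clock c).put [δ .conj]) hb hn hc hr
      refine (((runs_put [δ .conj] (m.set .clock c)).seq (hax.seq ((runs_put [δ .box] _).seq
        (runs_emit_set .depth [.sep] _)))).iter_set (m := m) (k := .clock) (a := a) (r := c) hm
          rfl |>.trans (ih _ rfl (by exact hb) (by exact hn)
            (by exact hc) (by exact hr))).conv ?_ ?_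
      · simp [Mem.put, Mem.set, Mem.fn, List.replicate_succ]
        rw [← List.cons_append, ← List.replicate_succ, List.replicate_succ']
        simp
      · simp only [Mem.set, Mem.put, List.length_cons, mul_add]
        omega
  refine (((iter m.clock m rfl hb hn hc hr).runs_nil rfl).seq ((runs_put _ _).seq
    (runs_drain (k := .depth) (by decide) [δ .close, δ .close] _))).conv ?_ ?_
  · obtain ⟨inp, copy, clock, bits', name, brackets, depth, acc, out⟩ := m
    dsimp only at hd
    subst hd
    rw [MDL.Formula.write_globally]
    simp [Mem.put, Mem.set, Mem.fn, List.map_flatten]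
  · simp only [Mem.set, Mem.fn, Mem.put, hd, List.append_nil, List.length_replicate, add_mul]
    omega

/-- Needed because the final reversal of the output takes time proportional to its length. -/
theorem length_write_globally_le (s : List Token) (n : ℕ) :
    (globally (updateAxioms (names [] s)) n).write.length ≤
      ((2 * Template.cost (axiomTemplates id) + 1) * s.length + 10) * n + 6 := by
  have h₁ := length_flatMap_names_le (axiomTemplates id) [] s
  have h₂ := length_names_le [] s
  have h₃ : (updateAxioms (names [] s)).write.length ≤
      (2 * Template.cost (axiomTemplates id) + 1) * s.length + 6 := by
    have : top.write.length = 6 := rfl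
    have h₄ : Template.cost (axiomTemplates id) * (2 * s.length + 0) =
      2 * Template.cost (axiomTemplates id) * s.length := by ring
    rw [MDL.Formula.write_updateAxioms]
    simp only [funext (expandAll_axiomTemplates id), List.map_id, List.length_append,
      List.length_replicate, List.length_nil, add_mul] at h₁ ⊢
    omega
  have h₅ : (List.replicate n (.conj :: ((updateAxioms (names [] s)).write ++
      [.box]))).flatten.length = ((updateAxioms (names [] s)).write.length + 2) * n := by
    simp [mul_comm]
  have h₆ : (List.replicate n [Token.close, .close]).flatten.length = 2 * n := by
    simp [mul_comm]
  have h₇ := Nat.mul_le_mul_right n (Nat.add_le_add_right h₃ 2)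
  have : top.write.length = 6 := rfl
  rw [MDL.Formula.write_globally]
  simp only [List.length_append, h₅, h₆, add_mul] at h₇ ⊢
  omega

/-- The templates for the translation of the existential quantifier. -/
def exTemplates : List Template := Template.word [.dia, .conj] :: Template.isUpdate

/-- The templates for the translation of the universal quantifier. -/
def allTemplates : List Template := exTemplates.map (·.map Token.dual)

theorem expandAll_exTemplates (p : PropVar) : Template.expandAll exTemplates p =
    .dia :: .conj :: (MDL.Formula.isUpdate p).write := by
  rw [exTemplates, Template.expandAll_cons, Template.expand_word, Template.expandAll_isUpdate]
  rfl

theorem expandAll_allTemplates (p : PropVar) : Template.expandAll allTemplates p =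
    .box :: .disj :: (MDL.Formula.isUpdate p).dual.write := by
  rw [allTemplates, Template.expandAll_map, expandAll_exTemplates, MDL.Formula.write_dual]
  rfl

/-- Read a name from the input and pass it to the templates. -/
def readName (ts : List Template) : StackProg Stk Token :=
  seq (loop .inp (fun a => decide (a = .sep)) fun a => emit .bits [a]) (writeFor ts)

theorem runs_readName (ts : List Template) (p : PropVar) (r : List Token) (m : Mem)
    (hi : m.inp = writeVar p ++ r) (hb : m.bits = []) (hn : m.name = []) :
    Runs (readName ts) m.fn ((m.set .inp r).put (Template.expandAll ts p)).fn
      ((Template.cost ts + 2) * (p.length + 1)) := by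
  have iter : ∀ (p : PropVar) (m : Mem), m.inp = writeVar p ++ r →
      Iter .inp (fun a => decide (a = .sep)) (fun a => emit .bits [a]) m.fn
        ((m.set .inp (.sep :: r)).set .bits ((p.map .bit).reverse ++ m.bits)).fn
        (2 * p.length) := by
    intro p
    induction p with
    | nil =>
      intro m hm
      obtain ⟨_, _, _, _, _, _, _, _, _⟩ := m
      dsimp only at hm
      subst hm
      exact Iter.refl _
    | cons b p ih =>
      intro m hm
      refine ((runs_emit_set .bits [.bit b] _).iter_set (m := m) (k := .inp) (a := .bit b)
        (r := writeVar p ++ r) hm rfl |>.trans (ih _ rfl)).conv ?_ ?_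
      · simp [Mem.set, Mem.fn]
      · simp only [List.length_cons]
        omega
  have h₁ := (iter p m hi).runs_end (a := .sep) (r := r) rfl rfl
  rw [← Mem.fn_set] at h₁
  refine (h₁.seq (runs_writeFor ts p _ ?_ hn)).conv ?_ ?_
  · simp [Mem.set, hb]
  · obtain ⟨_, _, _, _, _, _, _, _, _⟩ := m
    dsimp only at hb
    subst hb
    rfl
  · simp only [add_mul]
    omega

/-- Translate a symbol of the input. -/
def translate : Token → StackProg Stk Token
  | .sep => emit .acc [.bit true, .sep]
  | .dep => emit .acc (.conj :: (top.write ++ [.dep]))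
  | .conj => emit .acc (.conj :: (top.write ++ [.conj]))
  | .disj => emit .acc (.conj :: (top.write ++ [.disj]))
  | .ex => readName exTemplates
  | .all => readName allTemplates
  | .close => emit .acc [.close, .close]
  | t => emit .acc [t]

/-- A bound for the time to translate a string and for the length of the translation, relative to
the length of the string. -/
def rate : ℕ := Template.cost exTemplates + Template.cost allTemplates + 8

/-- The word `w` is the translation of the string `s`. -/
def Translates (s w : List Token) : Prop :=
  w.length ≤ rate * s.length ∧ ∀ (m : Mem) (r : List Token), m.inp = s ++ r → m.bits = [] →
    m.name = [] → Iter .inp (fun _ => false) translate m.fn ((m.set .inp r).put w).fn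
      (rate * s.length)

theorem Translates.append {s s' w w' : List Token} (h : Translates s w) (h' : Translates s' w') :
    Translates (s ++ s') (w ++ w') := by
  refine ⟨?_, fun m r hi hb hn => ?_⟩
  · have h₁ := h.1
    have h₂ := h'.1
    simp only [List.length_append, mul_add]
    omega
  · refine ((h.2 m (s' ++ r) (by simpa using hi) hb hn).trans (h'.2 _ r rfl hb hn)).conv ?_ ?_
    · simp [Mem.set, Mem.put]
    · simp [mul_add]

theorem translates_nil : Translates [] [] :=
  ⟨Nat.zero_le _, fun m r hi _ _ => (Iter.refl m.fn).conv (by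
    obtain ⟨_, _, _, _, _, _, _, _, _⟩ := m
    dsimp only at hi
    subst hi
    rfl) (Nat.zero_le _)⟩

theorem translates_singleton {a : Token} {w : List Token} (ha : translate a = emit .acc w)
    (hw : w.length ≤ 8) : Translates [a] w := by
  have hr : 8 ≤ rate := Nat.le_add_left _ _
  refine ⟨by simpa using hw.trans hr, fun m r hi hb hn => (Runs.iter_set (k := .inp) (m := m)
    (a := a) (r := r) (t := 1) ?_ hi rfl).mono ?_⟩
  · rw [ha]
    exact runs_put w _
  · simp only [List.length_singleton]
    omega

theorem translates_writeVar (p : PropVar) : Translates (writeVar p) (writeVar (copyVar p)) := by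
  induction p with
  | nil => exact translates_singleton rfl (by decide)
  | cons b p ih =>
    exact (translates_singleton (a := .bit b) (w := [.bit b]) rfl (by simp)).append ih

/-- The whole name is consumed within one iteration of the translating loop, since its symbols must
enter the formula `isUpdate`. -/
theorem translates_quantifier {a : Token} {ts : List Template} (ha : translate a = readName ts)
    (hts : Template.cost ts + 8 ≤ rate) (p : PropVar) :
    Translates (a :: writeVar p) (Template.expandAll ts p) := by
  have hl : (a :: writeVar p).length = p.length + 2 := by simp [writeVar]
  have hm := Nat.mul_le_mul_right (p.length + 2) hts
  refine ⟨?_, fun m r hi hb hn => (Runs.iter_set (k := .inp) (m := m) (a := a)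
    (r := writeVar p ++ r) (t := (Template.cost ts + 2) * (p.length + 1)) ?_ hi rfl).mono ?_⟩
  · have := Template.length_expandAll_le ts p
    rw [hl]
    simp only [mul_add, add_mul] at hm this ⊢
    omega
  · rw [ha]
    exact runs_readName ts p r (m.set .inp (writeVar p ++ r)) rfl hb hn
  · rw [hl]
    simp only [mul_add, add_mul] at hm ⊢
    omega

/-- A closing bracket always becomes two, without regard to what it closes. A quantifier yields a
modality around a binary connective; `toMDL` pads the other bracketed cases with a conjunction with
`top` to match. A separator becomes the extra bit of `copyVar` followed by a separator. -/
theorem translates_write (φ : QPDL.Formula) : Translates φ.write φ.toMDL.write := by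
  have hclose : Translates [.close] [.close, .close] := translates_singleton rfl (by decide)
  induction φ with
  | pos p | neg p =>
    exact (translates_singleton rfl (w := [_]) (by decide)).append (translates_writeVar p)
  | dep ps q =>
    have hv : ∀ l : List PropVar,
        Translates (l.flatMap writeVar) ((l.map copyVar).flatMap writeVar) := by
      intro l
      induction l with
      | nil => exact translates_nil
      | cons p l ih => exact (translates_writeVar p).append ih
    have := (translates_singleton (a := .dep) rfl (by decide)).append
      ((hv (ps ++ [q])).append hclose)
    simpa [QPDL.Formula.write, QPDL.Formula.toMDL, MDL.Formula.write] using this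
  | conj φ ψ ih₁ ih₂ =>
    have := (translates_singleton (a := .conj) rfl (by decide)).append
      (ih₁.append (ih₂.append hclose))
    simpa [QPDL.Formula.write, QPDL.Formula.toMDL, MDL.Formula.write] using this
  | disj φ ψ ih₁ ih₂ =>
    have := (translates_singleton (a := .disj) rfl (by decide)).append
      (ih₁.append (ih₂.append hclose))
    simpa [QPDL.Formula.write, QPDL.Formula.toMDL, MDL.Formula.write] using this
  | ex p φ ih =>
    have := (translates_quantifier (a := .ex) (ts := exTemplates) rfl (by unfold rate; omega)
      p).append (ih.append hclose)
    simpa [QPDL.Formula.write, QPDL.Formula.toMDL, MDL.Formula.write, expandAll_exTemplates]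
      using this
  | all p φ ih =>
    have := (translates_quantifier (a := .all) (ts := allTemplates) rfl (by unfold rate; omega)
      p).append (ih.append hclose)
    simpa [QPDL.Formula.write, QPDL.Formula.toMDL, MDL.Formula.write, expandAll_allTemplates]
      using this

theorem translates_writeSequent (S : List QPDL.Formula) (φ : QPDL.Formula) :
    Translates (writeSequent QPDL.Formula.write (S, φ))
      (writeSequent MDL.Formula.write (S.map QPDL.Formula.toMDL, φ.toMDL)) := by
  have h : Translates (S.flatMap QPDL.Formula.write)
      ((S.map QPDL.Formula.toMDL).flatMap MDL.Formula.write) := by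
    induction S with
    | nil => exact translates_nil
    | cons ψ S ih => exact (translates_write ψ).append ih
  exact h.append ((translates_singleton (a := .turnstile) (w := [.turnstile]) rfl
    (by decide)).append (translates_write φ))

/-- The program of the reductions. -/
def reduction (δ : Token → Token) (head tail : List Token) : StackProg Stk Token :=
  seq (loop .inp (fun _ => false) fun t => seq (emit .copy [t]) (emit .clock [t]))
    (seq (move .copy .inp) (seq (emit .acc head) (seq (writeGlobally δ)
      (seq (loop .inp (fun _ => false) translate) (seq (emit .acc tail) (move .acc .out))))))

/-- The running time of the reductions. -/
noncomputable def reductionTime (δ : Token → Token) (head tail : List Token) : Polynomial ℕ :=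
  3 * .X + 1 + (2 * .X + 1) + 1 +
    ((.C (2 * Template.cost (axiomTemplates δ) + 6) * .X + 11) * .X + 3) + (.C rate * .X + 1) + 1 +
    (2 * (.C head.length + ((.C (2 * Template.cost (axiomTemplates id) + 1) * .X + 10) * .X + 6) +
      .C rate * .X + .C tail.length) + 1)

/-- The clock holds one symbol for each symbol of the input, which makes `s.length` the nesting
depth of the axioms. The output accumulates in reverse on `acc` and is turned around by the last
move. -/
theorem runs_reduction (δ : Token → Token) (head tail : List Token) {s w : List Token}
    (h : Translates s w) :
    Runs (reduction δ head tail) (Function.update (fun _ => []) .inp s)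
      (Function.update (fun _ => []) .out (head ++
        ((globally (updateAxioms (names [] s)) s.length).write.map δ ++ (w ++ tail))))
      ((reductionTime δ head tail).eval s.length) := by
  have hfn : ({} : Mem).fn = fun _ => [] := funext fun k => by cases k <;> rfl
  have iter : ∀ (s : List Token) (m : Mem), m.inp = s →
      Iter .inp (fun _ => false) (fun t => seq (emit .copy [t]) (emit .clock [t])) m.fn
        (((m.set .inp []).set .copy (s.reverse ++ m.copy)).set .clock (s.reverse ++ m.clock)).fn
        (3 * s.length) := by
    intro s
    induction s with
    | nil =>
      intro m hm
      obtain ⟨_, _, _, _, _, _, _, _, _⟩ := m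
      dsimp only at hm
      subst hm
      exact Iter.refl _
    | cons a s ih =>
      intro m hm
      refine (((runs_emit_set .copy [a] _).seq (runs_emit_set .clock [a] _)).iter_set (m := m)
        (k := .inp) (a := a) (r := s) hm rfl |>.trans (ih _ rfl)).conv ?_ ?_
      · simp [Mem.set, Mem.fn]
      · simp only [List.length_cons]
        omega
  rw [← hfn, ← Mem.fn_set, ← Mem.fn_set]
  have hg := runs_writeGlobally δ
    (({ inp := s, clock := s.reverse } : Mem).put head) rfl rfl rfl rfl rfl
  have hglen := length_write_globally_le s s.length
  have ht := ((h.2 _ [] (by simp [Mem.set, Mem.put]) (by rfl) (by rfl)).runs_nil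
    (S := ((({ inp := s, clock := s.reverse } : Mem).put head).set .clock [] |>.put
      ((globally (updateAxioms (names [] s)) s.reverse.length).write.map δ)).fn) rfl)
  refine (((iter s (({} : Mem).set .inp s) rfl).runs_nil rfl).seq
    (((runs_move_set (k := .copy) (k' := .inp) (by decide) _).conv
      (m' := { inp := s, clock := s.reverse }) ?_ le_rfl).seq
    ((runs_put head _).seq (hg.seq (ht.seq ((runs_put tail _).seq
      (runs_move_set (k := .acc) (k' := .out) (by decide) _))))))).conv ?_ ?_
  · simp [Mem.set, Mem.fn]
  · simp [Mem.set, Mem.fn, Mem.put]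
  · have hw := h.1
    simp only [Mem.set, Mem.fn, Mem.put, reductionTime, Polynomial.eval_add, Polynomial.eval_mul,
      Polynomial.eval_X, Polynomial.eval_C, Polynomial.eval_one, Polynomial.eval_ofNat,
      List.length_append, List.length_reverse, List.length_nil, List.length_map]
    omega

theorem names_writeVar (acc : List Bool) (p : PropVar) (r : List Token) :
    names acc (writeVar p ++ r) = (acc.reverse ++ p) :: names [] r := by
  induction p generalizing acc with
  | nil => simp [writeVar, names]
  | cons b p ih =>
    have : writeVar (b :: p) ++ r = .bit b :: (writeVar p ++ r) := rfl
    rw [this, names, ih]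
    simp

/-- The raw scan for names sees exactly the variable occurrences, because separators are written
only after names. -/
theorem names_write (φ : QPDL.Formula) (r : List Token) :
    names [] (φ.write ++ r) = φ.occ ++ names [] r := by
  induction φ generalizing r with
  | dep ps q =>
    have hv : ∀ (l : List PropVar) (r : List Token),
        names [] (l.flatMap writeVar ++ r) = l ++ names [] r := by
      intro l r
      induction l with
      | nil => rfl
      | cons p l ih => simp [names_writeVar, ih]
    have := hv (ps ++ [q]) (.close :: r)
    rw [QPDL.Formula.write, QPDL.Formula.occ, List.cons_append, List.append_assoc,
      List.singleton_append, names, this, names]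
    all_goals simp
  | _ => simp_all [QPDL.Formula.write, QPDL.Formula.occ, names, names_writeVar]

end StackProg

namespace QPDL

theorem Formula.depth_le_length_write (φ : Formula) : φ.depth ≤ φ.write.length := by
  induction φ <;> simp only [depth, write, List.length_cons, List.length_append] <;> omega

open StackProg

theorem mem_names_writeSequent {S : List Formula} {φ ψ : Formula} (h : ψ ∈ φ :: S) {p : PropVar}
    (hp : p ∈ ψ.occ) : p ∈ names [] (writeSequent Formula.write (S, φ)) := by
  have key : ∀ (S : List Formula) (r : List Token),
      names [] (S.flatMap Formula.write ++ r) = S.flatMap Formula.occ ++ names [] r := by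
    intro S r
    induction S with
    | nil => rfl
    | cons χ S ih => rw [List.flatMap_cons, List.append_assoc, names_write, ih, List.flatMap_cons,
        List.append_assoc]
  have hφ := names_write φ []
  rw [List.append_nil] at hφ
  rw [writeSequent, key, names, hφ]
  · rcases List.mem_cons.1 h with rfl | h
    · simp [hp]
    · exact List.mem_append_left _ (List.mem_flatMap.2 ⟨ψ, h, hp⟩)
  all_goals simp

theorem length_write_le_writeSequent {S : List Formula} {φ ψ : Formula} (h : ψ ∈ φ :: S) :
    ψ.write.length ≤ (writeSequent Formula.write (S, φ)).length := by
  rw [writeSequent, List.length_append, List.length_cons]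
  rcases List.mem_cons.1 h with rfl | h
  · dsimp only
    omega
  · obtain ⟨S₁, S₂, rfl⟩ := List.append_of_mem h
    simp only [List.flatMap_append, List.flatMap_cons, List.length_append]
    omega

end QPDL

theorem writeSequent_cons {α : Type} (write : α → List Token) (x y : α) (l : List α) :
    writeSequent write (x :: l, y) = write x ++ writeSequent write (l, y) := by
  simp [writeSequent]

open StackProg in
theorem mainTheorem7 :
    PolyTimeReducible QPDL.encFormula MDL.encFormula QPDL.Satisfiable MDL.Satisfiable.{u} ∧
    PolyTimeReducible QPDL.encFormula MDL.encFormula QPDL.Valid MDL.Valid.{u} ∧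
    PolyTimeReducible QPDL.encSequent MDL.encSequent
      (fun i => QPDL.Entails {ψ | ψ ∈ i.1} i.2)
      (fun i => MDL.Entails.{u} {ψ | ψ ∈ i.1} i.2) := by
  have hocc : ∀ φ : QPDL.Formula, ∀ p ∈ φ.occ, p ∈ names [] φ.write := fun φ p hp => by
    have := names_write φ []
    rw [List.append_nil] at this
    simp [this, hp]
  refine ⟨⟨fun φ => .conj (.globally (.updateAxioms (names [] φ.write)) φ.write.length) φ.toMDL,
    polyTime (reduction id [.conj] [.close]) .inp .out
      (reductionTime id [.conj] [.close]) fun φ => ?_,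
    fun φ => QPDL.satisfiable_iff (hocc φ) φ.depth_le_length_write⟩,
    ⟨fun φ => .disj (MDL.Formula.globally (.updateAxioms (names [] φ.write)) φ.write.length).dual
      φ.toMDL,
    polyTime (reduction Token.dual [.disj] [.close]) .inp .out
      (reductionTime Token.dual [.disj] [.close]) fun φ => ?_,
    fun φ => QPDL.valid_iff (hocc φ) φ.depth_le_length_write⟩,
    ⟨fun i => (.globally (.updateAxioms (names [] (writeSequent QPDL.Formula.write i)))
      (writeSequent QPDL.Formula.write i).length :: i.1.map QPDL.Formula.toMDL, i.2.toMDL),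
    polyTime (reduction id [] []) .inp .out
      (reductionTime id [] []) fun i => ?_,
    fun i => QPDL.entails_iff (fun ψ hψ p hp => QPDL.mem_names_writeSequent hψ hp)
      fun ψ hψ => ψ.depth_le_length_write.trans (QPDL.length_write_le_writeSequent hψ)⟩⟩
  · have := runs_reduction id [.conj] [.close] (translates_write φ)
    rw [List.map_id] at this
    exact this
  · have := runs_reduction Token.dual [.disj] [.close] (translates_write φ)
    -- The symbolwise map applied by the program is recognized as the dual of the axioms.
    rw [← MDL.Formula.write_dual] at this
    exact this
  · have := runs_reduction id [] [] (translates_writeSequent i.1 i.2)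
    rw [List.map_id, List.append_nil, List.nil_append, ← writeSequent_cons] at this
    exact this
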